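/- Let $n$ be a natural number and $M\in\mathrm{GL}_n(\mathbb{C})$. Let $X=\{M^k\mid k\in\mathbb{Z}\}$ be the subgroup of $\mathrm{GL}_n(\mathbb{C})$ generated by $M$, and let $\overline{X}$ be its Zariski closure in the space $\mathrm{Mat}_n(\mathbb{C})\cong\mathbb{C}^{n^2}$ of all complex $n\times n$ matrices. Let $G(M)$ be the subgroup of $\mathbb{C}^*$ generated by the eigenvalues of $M$; it is a finitely generated abelian group, and we write $G(M)_{\mathrm{tor}}$ for its torsion subgroup and $\operatorname{rk}G(M)$ for its rank as a $\mathbb{Z}$-module. An affine variety is called toric if it is isomorphic to the Zariski closure in $\mathbb{C}^m$ of the image of a monomial map $(\mathbb{C}^*)^r\to(\mathbb{C}^*)^m$, $x\mapsto(x^{\alpha_1},\dots,x^{\alpha_m})$, for some $r,m\ge 0$ and $\alpha_1,\dots,\alpha_m\in\mathbb{Z}^r$ (no normality is required). Then $\overline{X}$ has exactly $|G(M)_{\mathrm{tor}}|$ irreducible components. Each irreducible component is a toric variety, any two irreducible components are isomorphic as affine varieties, and the dimension of each irreducible component, which is also the dimension of $\overline{X}$, is $$\dim\overline{X}=\begin{cases}\operatorname{rk}G(M)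 & \text{if } M \text{ is diagonalizable},\\ \operatorname{rk}G(M)+1 & \text{otherwise.}\end{cases}$$ -/

import Mathlib

/-- The complex affine space with coordinates indexed by `σ`. It is a type synonym of `σ → ℂ`
that carries the Zariski topology instead of the product topology. -/
def AffSpace (σ : Type*) : Type _ := σ → ℂ

namespace AffSpace

/-- The set of common zeros of a set of polynomials. -/
def zeros {σ : Type*} (S : Set (MvPolynomial σ ℂ)) : Set (AffSpace σ) :=
  {x | ∀ p ∈ S, MvPolynomial.eval (x : σ → ℂ) p = 0}

/-- The Zariski topology: the closed sets are the common zero sets of sets of polynomials. -/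
instance zariski (σ : Type*) : TopologicalSpace (AffSpace σ) :=
  TopologicalSpace.ofClosed (Set.range zeros)
    ⟨{1}, by ext x; simp [zeros]⟩
    (by
      intro A hA
      refine ⟨{p | ∃ S, zeros S ∈ A ∧ p ∈ S}, ?_⟩
      ext x
      simp only [zeros, Set.mem_ofPred_eq, Set.mem_sInter]
      constructor
      · intro h t ht
        obtain ⟨S, rfl⟩ := hA ht
        exact fun p hp => h p ⟨S, ht, hp⟩
      · rintro h p ⟨S, hS, hp⟩
        exact h _ hS p hp)
    (by
      rintro _ ⟨S, rfl⟩ _ ⟨T, rfl⟩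
      refine ⟨{r | ∃ p ∈ S, ∃ q ∈ T, r = p * q}, ?_⟩
      ext x
      simp only [zeros, Set.mem_ofPred_eq, Set.mem_union]
      constructor
      · intro h
        by_contra hx
        push Not at hx
        obtain ⟨⟨p, hp, hpx⟩, ⟨q, hq, hqx⟩⟩ := hx
        have := h _ ⟨p, hp, q, hq, rfl⟩
        rw [map_mul] at this
        exact (mul_ne_zero hpx hqx) this
      · rintro h _ ⟨p, hp, q, hq, rfl⟩
        rw [map_mul]
        rcases h with h | h
        · rw [h p hp, zero_mul]
        · rw [h q hq, mul_zero])

theorem isClosed_iff {σ : Type*} (Z : Set (AffSpace σ)) :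
    IsClosed Z ↔ ∃ S : Set (MvPolynomial σ ℂ), Z = zeros S := by
  rw [← isOpen_compl_iff]
  change Zᶜᶜ ∈ Set.range zeros ↔ _
  rw [compl_compl]
  exact ⟨fun ⟨S, h⟩ => ⟨S, h.symm⟩, fun ⟨S, h⟩ => ⟨S, h.symm⟩⟩

/-- The irreducible components of a subset `Z` of affine space (with its subspace topology),
as subsets of the ambient space. -/
def components {σ : Type*} (Z : Set (AffSpace σ)) : Set (Set (AffSpace σ)) :=
  (fun C : Set Z => (Subtype.val '' C : Set (AffSpace σ))) '' irreducibleComponents Z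

/-- The polynomial map between affine spaces with components `F t`. -/
noncomputable def polyMap {σ τ : Type*} (F : τ → MvPolynomial σ ℂ) (x : AffSpace σ) :
    AffSpace τ :=
  fun t => MvPolynomial.eval (x : σ → ℂ) (F t)

/-- `V` and `W` are isomorphic as (embedded) affine varieties: there are polynomial maps
`V → W` and `W → V` that are inverse to each other. -/
def Isomorphic {σ τ : Type*} (V : Set (AffSpace σ)) (W : Set (AffSpace τ)) : Prop :=
  ∃ (F : τ → MvPolynomial σ ℂ) (G : σ → MvPolynomial τ ℂ),
    (∀ x ∈ V, polyMap F x ∈ W ∧ polyMap G (polyMap F x) = x) ∧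
    (∀ y ∈ W, polyMap G y ∈ V ∧ polyMap F (polyMap G y) = y)

/-- The monomial map `(ℂ*)^r → (ℂ*)^m ⊆ ℂ^m`, `x ↦ (x^{α_1}, …, x^{α_m})`, of lattice points
`α_1, …, α_m ∈ ℤ^r`. -/
def monomialMap {r m : ℕ} (α : Fin m → Fin r → ℤ) (x : Fin r → ℂˣ) : AffSpace (Fin m) :=
  fun i => ((∏ j, x j ^ α i j : ℂˣ) : ℂ)

/-- The Zariski closure in `ℂ^m` of the image of a monomial map. -/
def toricModel {r m : ℕ} (α : Fin m → Fin r → ℤ) : Set (AffSpace (Fin m)) :=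
  closure (Set.range (monomialMap α))

/-- An affine variety is toric if it is isomorphic to the Zariski closure of the image of a
monomial map. -/
def IsToric {σ : Type*} (V : Set (AffSpace σ)) : Prop :=
  ∃ (r m : ℕ) (α : Fin m → Fin r → ℤ), Isomorphic V (toricModel α)

end AffSpace

/-- A square matrix as a point of the affine space `ℂ^(n²)`. -/
def Matrix.toAff {n : ℕ} (A : Matrix (Fin n) (Fin n) ℂ) : AffSpace (Fin n × Fin n) :=
  fun p => A p.1 p.2

/-- The Zariski closure, in the space of all `n × n` matrices, of the group generated by `M`. -/
def cyclicClosure {n : ℕ} (M : GL (Fin n) ℂ) : Set (AffSpace (Fin n × Fin n)) :=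
  closure ((fun g : GL (Fin n) ℂ => (g : Matrix (Fin n) (Fin n) ℂ).toAff) ''
    (Subgroup.zpowers M : Set (GL (Fin n) ℂ)))

/-- The multiplicative group `G(M)`, generated in `ℂ*` by the nonzero eigenvalues of `M`. -/
def eigenvalueGroup {n : ℕ} (M : Matrix (Fin n) (Fin n) ℂ) : Subgroup ℂˣ :=
  Subgroup.closure {u : ℂˣ | Module.End.HasEigenvalue (Matrix.toLin' M) (u : ℂ)}

/-- `M` is diagonalizable: similar to a diagonal matrix. -/
def Matrix.IsDiagonalizable {n : ℕ} (M : Matrix (Fin n) (Fin n) ℂ) : Prop :=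
  ∃ (P : GL (Fin n) ℂ) (d : Fin n → ℂ),
    M = (P : Matrix (Fin n) (Fin n) ℂ) * Matrix.diagonal d *
      ((P⁻¹ : GL (Fin n) ℂ) : Matrix (Fin n) (Fin n) ℂ)

/-- The rank of an abelian group, written multiplicatively: its rank as a `ℤ`-module. -/
noncomputable def groupRank (G : Type*) [CommGroup G] : ℕ :=
  Module.finrank ℤ (Additive G)

/-!
The Zariski closure of a cyclic matrix group is described by exponential polynomials.

Let `p` be the minimal polynomial of `M`. Each matrix entry of `M^k` is a solution, as a function of
`k ∈ ℤ`, of the linear recurrence with characteristic polynomial `p`, and every solution is a linear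
functional of `M^k` (`exists_dual_of_mem_ker`). A basis of the solutions is given by the functions
`k ↦ k^j λ^k` with `λ` a root of `p` and `j` less than its multiplicity (`span_expPoly_roots`).
Hence a linear change of coordinates turns `M^k` into the point with coordinates `k^j λ^k`
(`isomorphic_powPoint_expPoly`), and no Jordan form is needed.

Let `N` be the order of the torsion of the eigenvalue group, and `r` the rank. There are
multiplicatively independent numbers `b_1, …, b_r` with `λ^N = b^α(λ)`, where the exponents `α(λ)`
generate `ℤ^r` (`exists_exponents`). For `k = N l` the coordinates become `(N l)^j b^(l α(λ))`.
The functions `l ↦ l^w b^(l β)` are linearly independent (`linearIndependent_expMonomial`), since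
different `b^β` belong to different generalized eigenspaces of the shift operator. So these points
satisfy the same polynomial relations as the monomials `s^j t^α(λ)` on a torus: in both cases the
ideal of relations is the kernel of a homomorphism to the algebra of a monoid
(`AffSpace.vanishing_range`). This makes the closure `X₀` of the powers `M^(N l)` a toric variety
(`exists_isomorphic_toricModel`), irreducible because Laurent polynomials form a domain. Its
exponents generate a lattice of rank `r` if all multiplicities are one, that is, if `M` is
diagonalizable, and of rank `r + 1` otherwise, because then `s` occurs.

The dimension of a toric variety whose exponents generate the lattice is the rank of the lattice
(`AffSpace.topologicalKrullDim_toricModel`): by the Nullstellensatz it is the Krull dimension of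
the coordinate ring, which by Noether normalization is the transcendence degree of that ring, and
the Laurent polynomials are algebraic over it.

Finally the closure of all powers of `M` is the union of the translates `M^a X₀` for `0 ≤ a < N`,
all isomorphic to `X₀`. None lies in another (`eq_of_closure_residue_subset`): a generator `ζ` of
the torsion is a product of powers of eigenvalues, so that `M^k ↦ ζ^k` is a quotient of polynomial
functions, and it takes the value `ζ^a` on the powers of `M` in `M^a X₀`. So these translates are
the irreducible components.
-/

/-! ### Zariski closures, polynomial maps and irreducible components -/

theorem Topology.IsInducing.isPreirreducible_of_image {X Y : Type*} [TopologicalSpace X]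
    [TopologicalSpace Y] {f : X → Y} (hf : Topology.IsInducing f) {T : Set X}
    (h : IsPreirreducible (f '' T)) : IsPreirreducible T := by
  intro U V hU hV hTU hTV
  obtain ⟨U', hU', rfl⟩ := hf.isOpen_iff.1 hU
  obtain ⟨V', hV', rfl⟩ := hf.isOpen_iff.1 hV
  obtain ⟨x, hx, hxU⟩ := hTU
  obtain ⟨y, hy, hyV⟩ := hTV
  obtain ⟨_, ⟨z, hz, rfl⟩, hzU⟩ :=
    h U' V' hU' hV' ⟨f x, ⟨x, hx, rfl⟩, hxU⟩ ⟨f y, ⟨y, hy, rfl⟩, hyV⟩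
  exact ⟨z, hz, hzU⟩

namespace AffSpace

variable {σ τ υ : Type*}

/-- Evaluation of polynomials at a point of affine space. -/
noncomputable def evalAt (x : AffSpace σ) : MvPolynomial σ ℂ →+* ℂ :=
  MvPolynomial.eval (x : σ → ℂ)

@[simp] theorem evalAt_X (x : AffSpace σ) (s : σ) : evalAt x (MvPolynomial.X s) = x s :=
  MvPolynomial.eval_X s

@[simp] theorem evalAt_C (x : AffSpace σ) (c : ℂ) : evalAt x (MvPolynomial.C c) = c :=
  MvPolynomial.eval_C c

theorem mem_zeros {S : Set (MvPolynomial σ ℂ)} {x : AffSpace σ} :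
    x ∈ zeros S ↔ ∀ p ∈ S, evalAt x p = 0 := Iff.rfl

theorem isClosed_zeros (S : Set (MvPolynomial σ ℂ)) : IsClosed (zeros S) :=
  (isClosed_iff _).2 ⟨S, rfl⟩

/-- The ideal of the polynomials that vanish on a subset of affine space. -/
noncomputable def vanishing (Z : Set (AffSpace σ)) : Ideal (MvPolynomial σ ℂ) :=
  MvPolynomial.vanishingIdeal ℂ (Z : Set (σ → ℂ))

theorem mem_vanishing {Z : Set (AffSpace σ)} {p : MvPolynomial σ ℂ} :
    p ∈ vanishing Z ↔ ∀ z ∈ Z, evalAt z p = 0 := by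
  refine forall₂_congr fun z _ => ?_
  rw [MvPolynomial.aeval_eq_eval]
  rfl

theorem mem_closure_iff_vanishing {Z : Set (AffSpace σ)} {x : AffSpace σ} :
    x ∈ closure Z ↔ ∀ p ∈ vanishing Z, evalAt x p = 0 := by
  constructor
  · intro hx p hp
    refine closure_minimal (fun z hz q hq => ?_) (isClosed_zeros {p}) hx p rfl
    rw [Set.mem_singleton_iff.1 hq]
    exact mem_vanishing.1 hp z hz
  · intro h
    simp only [closure, Set.mem_sInter, Set.mem_ofPred_eq, and_imp]
    intro C hC hZC
    obtain ⟨S, rfl⟩ := (isClosed_iff C).1 hC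
    exact fun p hp => h p (mem_vanishing.2 fun z hz => hZC hz p hp)

theorem closure_eq_zeros (Z : Set (AffSpace σ)) : closure Z = zeros (vanishing Z) := by
  ext x
  exact mem_closure_iff_vanishing

theorem evalAt_polyMap (F : τ → MvPolynomial σ ℂ) (x : AffSpace σ) (p : MvPolynomial τ ℂ) :
    evalAt (polyMap F x) p = evalAt x (MvPolynomial.bind₁ F p) :=
  (MvPolynomial.eval₂Hom_bind₁ (RingHom.id ℂ) x F p).symm

theorem continuous_polyMap (F : τ → MvPolynomial σ ℂ) : Continuous (polyMap F) := by
  refine continuous_iff_isClosed.2 fun C hC => ?_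
  obtain ⟨S, rfl⟩ := (isClosed_iff C).1 hC
  refine (isClosed_iff _).2 ⟨MvPolynomial.bind₁ F '' S, ?_⟩
  ext x
  simp only [Set.mem_preimage, mem_zeros, Set.forall_mem_image, ← evalAt_polyMap]

theorem polyMap_polyMap (F : τ → MvPolynomial σ ℂ) (G : υ → MvPolynomial τ ℂ) (x : AffSpace σ) :
    polyMap G (polyMap F x) = polyMap (fun u => MvPolynomial.bind₁ F (G u)) x := by
  funext u
  exact evalAt_polyMap F x (G u)

/-- The agreement of a polynomial self-map with the identity is a closed condition. -/
theorem polyMap_eq_self_of_mem_closure (F : σ → MvPolynomial σ ℂ) {Z : Set (AffSpace σ)}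
    (h : ∀ z ∈ Z, polyMap F z = z) : ∀ x ∈ closure Z, polyMap F x = x := by
  intro x hx
  funext s
  have := mem_closure_iff_vanishing.1 hx (F s - MvPolynomial.X s) <|
    mem_vanishing.2 fun z hz => by
      rw [map_sub, evalAt_X, sub_eq_zero]
      exact congrFun (h z hz) s
  rwa [map_sub, evalAt_X, sub_eq_zero] at this

theorem polyMap_closure_leftInverse (F : τ → MvPolynomial σ ℂ) (G : σ → MvPolynomial τ ℂ)
    {V : Set (AffSpace σ)} {W : Set (AffSpace τ)}
    (h : ∀ x ∈ V, polyMap F x ∈ W ∧ polyMap G (polyMap F x) = x) :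
    ∀ x ∈ closure V, polyMap F x ∈ closure W ∧ polyMap G (polyMap F x) = x := by
  intro x hx
  refine ⟨map_mem_closure (continuous_polyMap F) hx fun v hv => (h v hv).1, ?_⟩
  rw [polyMap_polyMap]
  refine polyMap_eq_self_of_mem_closure _ (fun z hz => ?_) x hx
  rw [← polyMap_polyMap]
  exact (h z hz).2

namespace Isomorphic

variable {V : Set (AffSpace σ)} {W : Set (AffSpace τ)} {U : Set (AffSpace υ)}

theorem symm (h : Isomorphic V W) : Isomorphic W V := by
  obtain ⟨F, G, hF, hG⟩ := h
  exact ⟨G, F, hG, hF⟩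

theorem trans (h : Isomorphic V W) (h' : Isomorphic W U) : Isomorphic V U := by
  obtain ⟨F, G, hF, hG⟩ := h
  obtain ⟨F', G', hF', hG'⟩ := h'
  refine ⟨fun u => MvPolynomial.bind₁ F (F' u), fun s => MvPolynomial.bind₁ G' (G s),
    fun x hx => ?_, fun y hy => ?_⟩
  · rw [← polyMap_polyMap F F', ← polyMap_polyMap G' G]
    refine ⟨(hF' _ (hF x hx).1).1, ?_⟩
    rw [(hF' _ (hF x hx).1).2, (hF x hx).2]
  · rw [← polyMap_polyMap F F', ← polyMap_polyMap G' G]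
    refine ⟨(hG _ (hG' y hy).1).1, ?_⟩
    rw [(hG _ (hG' y hy).1).2, (hG' y hy).2]

/-- Polynomial maps that are inverse to each other between two sets remain so between their
Zariski closures. -/
protected theorem closure (h : Isomorphic V W) : Isomorphic (closure V) (closure W) := by
  obtain ⟨F, G, hF, hG⟩ := h
  exact ⟨F, G, polyMap_closure_leftInverse F G hF, polyMap_closure_leftInverse G F hG⟩

theorem exists_homeomorph (h : Isomorphic V W) : Nonempty (V ≃ₜ W) := by
  obtain ⟨F, G, hF, hG⟩ := h
  exact ⟨{
    toFun := fun x => ⟨polyMap F x, (hF x x.2).1⟩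
    invFun := fun y => ⟨polyMap G y, (hG y y.2).1⟩
    left_inv := fun x => Subtype.ext (hF x x.2).2
    right_inv := fun y => Subtype.ext (hG y y.2).2
    continuous_toFun := ((continuous_polyMap F).comp continuous_subtype_val).subtype_mk _
    continuous_invFun := ((continuous_polyMap G).comp continuous_subtype_val).subtype_mk _ }⟩

theorem topologicalKrullDim_eq (h : Isomorphic V W) :
    topologicalKrullDim V = topologicalKrullDim W := by
  obtain ⟨e⟩ := h.exists_homeomorph
  exact IsHomeomorph.topologicalKrullDim_eq e e.isHomeomorph

theorem isIrreducible (h : Isomorphic V W) (hV : IsIrreducible V) : IsIrreducible W := by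
  obtain ⟨F, G, hF, hG⟩ := h
  have : polyMap F '' V = W := by
    ext y
    constructor
    · rintro ⟨x, hx, rfl⟩
      exact (hF x hx).1
    · exact fun hy => ⟨_, (hG y hy).1, (hG y hy).2⟩
  rw [← this]
  exact hV.image _ (continuous_polyMap F).continuousOn

end Isomorphic

theorem isIrreducible_closure {Z : Set (AffSpace σ)} (h : (vanishing Z).IsPrime) :
    IsIrreducible (closure Z) := by
  rw [isIrreducible_iff_closure]
  refine ⟨?_, isPreirreducible_iff_isClosed_union_isClosed.2 ?_⟩
  · by_contra hne
    rw [Set.not_nonempty_iff_eq_empty] at hne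
    exact h.ne_top ((Ideal.eq_top_iff_one _).2 (mem_vanishing.2 (by simp [hne])))
  intro A B hA hB hZ
  obtain ⟨S, rfl⟩ := (isClosed_iff A).1 hA
  obtain ⟨T, rfl⟩ := (isClosed_iff B).1 hB
  by_contra hcon
  simp only [not_or, Set.not_subset, mem_zeros, not_forall] at hcon
  obtain ⟨⟨x, hx, p, hp, hpx⟩, ⟨y, hy, q, hq, hqy⟩⟩ := hcon
  have hpq : p * q ∈ vanishing Z := by
    refine mem_vanishing.2 fun z hz => ?_
    rw [map_mul]
    rcases hZ hz with h1 | h1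
    · rw [mem_zeros.1 h1 p hp, zero_mul]
    · rw [mem_zeros.1 h1 q hq, mul_zero]
  rcases h.mem_or_mem hpq with h1 | h1
  · exact hpx (mem_vanishing.1 h1 x hx)
  · exact hqy (mem_vanishing.1 h1 y hy)

theorem isPrime_vanishing {C : Set (AffSpace σ)} (hC : IsIrreducible C) :
    (vanishing C).IsPrime := by
  constructor
  · obtain ⟨x, hx⟩ := hC.nonempty
    intro h
    have := mem_vanishing.1 ((Ideal.eq_top_iff_one _).1 h) x hx
    simp at this
  · intro p q hpq
    have := isPreirreducible_iff_isClosed_union_isClosed.1 hC.isPreirreducible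
      (zeros {p}) (zeros {q}) (isClosed_zeros _) (isClosed_zeros _) ?_
    · exact this.imp (fun h => mem_vanishing.2 fun x hx => h hx p rfl)
        (fun h => mem_vanishing.2 fun x hx => h hx q rfl)
    · intro x hx
      have h := mem_vanishing.1 hpq x hx
      rw [map_mul, mul_eq_zero] at h
      exact h.imp (fun h => mem_zeros.2 (by simpa using h))
        (fun h => mem_zeros.2 (by simpa using h))

theorem components_iUnion {ι : Type*} [Finite ι] (C : ι → Set (AffSpace σ))
    (hcl : ∀ i, IsClosed (C i)) (hirr : ∀ i, IsIrreducible (C i))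
    (hinj : ∀ i j, C i ⊆ C j → i = j) : components (⋃ i, C i) = Set.range C := by
  have hsub : ∀ i, C i ⊆ ⋃ i, C i := Set.subset_iUnion C
  -- an irreducible subset of the union lies in one of the pieces
  have hle : ∀ T : Set (AffSpace σ), IsIrreducible T → T ⊆ ⋃ i, C i → ∃ i, T ⊆ C i := by
    intro T hT hTs
    have := isIrreducible_iff_sUnion_isClosed.1 hT (Set.finite_range C).toFinset
      (by simpa using hcl) (by simpa using hTs)
    simpa using this
  have himg : ∀ T : Set (⋃ i, C i), IsIrreducible T →
      IsIrreducible (Subtype.val '' T : Set (AffSpace σ)) := fun T hT =>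
    hT.image _ continuous_subtype_val.continuousOn
  have hpre : ∀ i, IsIrreducible (Subtype.val ⁻¹' C i : Set (⋃ i, C i)) := by
    intro i
    have : (Subtype.val ⁻¹' C i : Set (⋃ i, C i)) = Set.range (Set.inclusion (hsub i)) := by
      rw [Set.range_inclusion]; rfl
    rw [this, ← Set.image_univ]
    have := Subtype.irreducibleSpace (hirr i)
    exact (IrreducibleSpace.isIrreducible_univ _).image _ (continuous_inclusion _).continuousOn
  have hval : ∀ i, Subtype.val '' (Subtype.val ⁻¹' C i : Set (⋃ i, C i)) = C i := by
    intro i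
    rw [Subtype.image_preimage_coe]
    exact Set.inter_eq_right.2 (hsub i)
  ext D
  constructor
  · rintro ⟨T, hT, rfl⟩
    obtain ⟨i, hi⟩ := hle _ (himg T hT.1) (by rintro _ ⟨x, -, rfl⟩; exact x.2)
    have h1 : T ⊆ Subtype.val ⁻¹' C i := Set.image_subset_iff.1 hi
    have h2 : T = Subtype.val ⁻¹' C i := h1.antisymm (hT.2 (hpre i) h1)
    exact ⟨i, by change C i = Subtype.val '' T; rw [h2, hval]⟩
  · rintro ⟨i, rfl⟩
    refine ⟨_, ⟨hpre i, fun T hT hiT => ?_⟩, hval i⟩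
    obtain ⟨j, hj⟩ := hle _ (himg T hT) (by rintro _ ⟨x, -, rfl⟩; exact x.2)
    have : C i ⊆ C j := by
      rw [← hval i]
      exact (Set.image_mono hiT).trans hj
    obtain rfl := hinj i j this
    exact Set.image_subset_iff.1 hj

/-- Each chain of irreducible closed subsets of the union lies in the piece that contains its
largest member. -/
theorem topologicalKrullDim_iUnion {X ι : Type*} [TopologicalSpace X] [Finite ι] [Nonempty ι]
    (C : ι → Set X) (hcl : ∀ i, IsClosed (C i)) (d : WithBot ℕ∞)
    (hd : ∀ i, topologicalKrullDim (C i) = d) : topologicalKrullDim ↥(⋃ i, C i) = d := by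
  have hsub : ∀ i, C i ⊆ ⋃ i, C i := Set.subset_iUnion C
  apply le_antisymm
  · rw [topologicalKrullDim, Order.krullDim_eq_iSup_height, iSup_le_iff]
    intro T
    rw [Order.height_eq_krullDim_Iic]
    have := isIrreducible_iff_sUnion_isClosed.1
      (T.isIrreducible.image Subtype.val continuous_subtype_val.continuousOn)
      (Set.finite_range C).toFinset (by simpa using hcl) (by
        rintro _ ⟨x, -, rfl⟩
        simpa only [Set.Finite.coe_toFinset, Set.sUnion_range] using x.2)
    obtain ⟨i, hi⟩ : ∃ i, Subtype.val '' (T : Set ↥(⋃ i, C i)) ⊆ C i := by simpa using this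
    rw [← hd i]
    have hS : ∀ S : Set.Iic T, ∀ x ∈ (S : TopologicalSpace.IrreducibleCloseds ↥(⋃ i, C i)),
        (x : X) ∈ C i := fun S x hx => hi ⟨x, S.2 hx, rfl⟩
    have himg : ∀ S : Set.Iic T,
        (Set.inclusion (hsub i)) '' (Set.inclusion (hsub i) ⁻¹' (S : Set ↥(⋃ i, C i))) =
          ((S : TopologicalSpace.IrreducibleCloseds ↥(⋃ i, C i)) : Set ↥(⋃ i, C i)) := by
      intro S
      rw [Set.image_preimage_eq_iff]
      intro x hx
      exact ⟨⟨x, hS S x hx⟩, rfl⟩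
    refine Order.krullDim_le_of_strictMono (fun S => ⟨Set.inclusion (hsub i) ⁻¹' S, ?_, ?_⟩) ?_
    · have hind : Topology.IsInducing (Set.inclusion (hsub i)) :=
        (Topology.IsEmbedding.inclusion (hsub i)).isInducing
      have h := S.1.isIrreducible
      rw [← himg S] at h
      refine ⟨?_, ?_⟩
      · exact h.nonempty.of_image
      · exact hind.isPreirreducible_of_image h.isPreirreducible
    · exact S.1.isClosed.preimage (continuous_inclusion _)
    · intro S S' h
      refine ⟨fun x hx => h.1 hx, fun h' => h.2 ?_⟩
      have h' : Set.inclusion (hsub i) ⁻¹' (S' : Set ↥(⋃ i, C i)) ⊆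
        Set.inclusion (hsub i) ⁻¹' (S : Set ↥(⋃ i, C i)) := h'
      have := Set.image_mono (f := Set.inclusion (hsub i)) h'
      rwa [himg, himg] at this
  · obtain ⟨i⟩ := ‹Nonempty ι›
    rw [← hd i]
    exact ((Topology.IsEmbedding.inclusion (hsub i)).isInducing).topologicalKrullDim_le

end AffSpace

/-! ### Dimension and transcendence degree -/

/-- Integral extensions preserve the Krull dimension: chains of
primes lift by going up, and stay strict on contraction by incomparability. -/
theorem ringKrullDim_eq_of_isIntegral_of_injective {R S : Type*} [CommRing R] [CommRing S]
    [Algebra R S] [Algebra.IsIntegral R S] (hinj : Function.Injective (algebraMap R S)) :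
    ringKrullDim S = ringKrullDim R := by
  apply le_antisymm
  · refine Order.krullDim_le_of_strictMono (PrimeSpectrum.comap (algebraMap R S)) ?_
    intro P Q hPQ
    exact Ideal.IsIntegral.comap_lt_comap (R := R) (I := P.asIdeal) (J := Q.asIdeal) hPQ
  · refine iSup_le fun l => ?_
    have : FaithfulSMul R S := (faithfulSMul_iff_algebraMap_injective R S).2 hinj
    obtain ⟨P, hP, hPl⟩ := (inferInstance : Nonempty (Ideal.primesOver l.head.asIdeal S))
    obtain ⟨L, hL, -⟩ := Ideal.exists_ltSeries_of_hasGoingUp (S := S) l P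
    rw [← hL]
    exact le_iSup (fun p : LTSeries (PrimeSpectrum S) => (p.length : WithBot ℕ∞)) L

/-- By Noether normalization the domain is integral over a polynomial ring, whose number of
variables is both its Krull dimension and its transcendence degree. -/
theorem ringKrullDim_eq_of_trdeg_eq (k A : Type*) [Field k] [CommRing A] [IsDomain A] [Algebra k A]
    [Algebra.FiniteType k A] (r : ℕ) (h : Algebra.trdeg k A = r) : ringKrullDim A = r := by
  obtain ⟨s, g, hinj, hint⟩ := exists_integral_inj_algHom_of_fg k A
  let : Algebra (MvPolynomial (Fin s) k) A := g.toRingHom.toAlgebra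
  have : IsScalarTower k (MvPolynomial (Fin s) k) A := IsScalarTower.of_algHom g
  have : Algebra.IsIntegral (MvPolynomial (Fin s) k) A := ⟨hint⟩
  have hi : Function.Injective (algebraMap (MvPolynomial (Fin s) k) A) := hinj
  have : FaithfulSMul (MvPolynomial (Fin s) k) A := (faithfulSMul_iff_algebraMap_injective _ _).2 hi
  have h1 := lift_trdeg_add_eq k (MvPolynomial (Fin s) k) A
  rw [h, MvPolynomial.trdeg_of_isDomain, trdeg_eq_zero] at h1
  have hs : s = r := by
    simp at h1
    exact_mod_cast h1
  rw [ringKrullDim_eq_of_isIntegral_of_injective hi, MvPolynomial.ringKrullDim_of_isNoetherianRing,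
    ringKrullDim_eq_zero_of_field, hs]
  simp

namespace AffSpace

variable {σ : Type*}

/-- The dimension of a closed subset of affine space is the Krull dimension of its coordinate
ring, by the Nullstellensatz. -/
theorem topologicalKrullDim_closure [Finite σ] (Z : Set (AffSpace σ)) :
    topologicalKrullDim (closure Z) = ringKrullDim (MvPolynomial σ ℂ ⧸ vanishing Z) := by
  rw [ringKrullDim_quotient, ← Order.krullDim_orderDual]
  have hval : ∀ C : TopologicalSpace.IrreducibleCloseds (closure Z),
      IsIrreducible (Subtype.val '' (C : Set (closure Z)) : Set (AffSpace σ)) := fun C =>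
    C.isIrreducible.image _ continuous_subtype_val.continuousOn
  have hcl : ∀ C : TopologicalSpace.IrreducibleCloseds (closure Z),
      IsClosed (Subtype.val '' (C : Set (closure Z)) : Set (AffSpace σ)) := fun C =>
    isClosed_closure.isClosedEmbedding_subtypeVal.isClosedMap _ C.isClosed
  apply le_antisymm
  · refine Order.krullDim_le_of_strictMono
      (fun C => OrderDual.toDual ⟨⟨vanishing (Subtype.val '' (C : Set (closure Z))),
        isPrime_vanishing (hval C)⟩, fun p hp => ?_⟩) ?_
    · refine mem_vanishing.2 ?_
      rintro _ ⟨x, -, rfl⟩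
      exact mem_closure_iff_vanishing.1 x.2 p hp
    · intro C D hCD
      have himg := Set.image_mono (f := (Subtype.val : closure Z → AffSpace σ)) hCD.1
      refine ⟨fun p hp => mem_vanishing.2 fun x hx => mem_vanishing.1 hp x (himg hx), fun h => ?_⟩
      refine hCD.2 ?_
      have h : vanishing (Subtype.val '' (C : Set (closure Z))) ≤
        vanishing (Subtype.val '' (D : Set (closure Z))) := h
      have h2 : (Subtype.val '' (D : Set (closure Z)) : Set (AffSpace σ)) ⊆
          Subtype.val '' (C : Set (closure Z)) := by
        rw [← (hcl C).closure_eq]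
        intro x hx
        exact mem_closure_iff_vanishing.2 fun p hp => mem_vanishing.1 (h hp) x hx
      exact (Set.image_subset_image_iff Subtype.val_injective).1 h2
  · have hvan : ∀ P : PrimeSpectrum (MvPolynomial σ ℂ),
        vanishing (zeros (P.asIdeal : Set (MvPolynomial σ ℂ))) = P.asIdeal := by
      intro P
      have := MvPolynomial.IsPrime.vanishingIdeal_zeroLocus (K := ℂ) P.asIdeal
      conv_rhs => rw [← this]
      unfold vanishing
      congr 1
    have hsub : ∀ P : PrimeSpectrum.zeroLocus (R := MvPolynomial σ ℂ) (vanishing Z),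
        zeros (P.1.asIdeal : Set (MvPolynomial σ ℂ)) ⊆ closure Z := by
      intro P x hx
      exact mem_closure_iff_vanishing.2 fun p hp => hx p (P.2 hp)
    have himg : ∀ P : PrimeSpectrum.zeroLocus (R := MvPolynomial σ ℂ) (vanishing Z),
        Subtype.val '' (Subtype.val ⁻¹' zeros (P.1.asIdeal : Set (MvPolynomial σ ℂ)) :
          Set (closure Z)) = zeros (P.1.asIdeal : Set (MvPolynomial σ ℂ)) := by
      intro P
      rw [Subtype.image_preimage_coe]
      exact Set.inter_eq_right.2 (hsub P)
    have hirr : ∀ P : PrimeSpectrum.zeroLocus (R := MvPolynomial σ ℂ) (vanishing Z),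
        IsIrreducible (Subtype.val ⁻¹' zeros (P.1.asIdeal : Set (MvPolynomial σ ℂ)) :
          Set (closure Z)) := by
      intro P
      have h : IsIrreducible (zeros (P.1.asIdeal : Set (MvPolynomial σ ℂ))) := by
        rw [← (isClosed_zeros _).closure_eq]
        apply isIrreducible_closure
        rw [hvan]
        exact P.1.isPrime
      rw [← himg P] at h
      exact ⟨h.nonempty.of_image,
        Topology.IsInducing.subtypeVal.isPreirreducible_of_image h.isPreirreducible⟩
    refine Order.krullDim_le_of_strictMono
      (fun P => ⟨Subtype.val ⁻¹' zeros ((OrderDual.ofDual P).1.asIdeal : Set (MvPolynomial σ ℂ)),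
        hirr (OrderDual.ofDual P), (isClosed_zeros _).preimage continuous_subtype_val⟩) ?_
    intro P Q hPQ
    refine ⟨fun x hx p hp => hx p (hPQ.1 hp), fun h => hPQ.2 ?_⟩
    have h : (Subtype.val ⁻¹' zeros ((OrderDual.ofDual Q).1.asIdeal : Set (MvPolynomial σ ℂ)) :
        Set (closure Z)) ⊆
      Subtype.val ⁻¹' zeros ((OrderDual.ofDual P).1.asIdeal : Set (MvPolynomial σ ℂ)) := h
    have h' := Set.image_mono (f := (Subtype.val : closure Z → AffSpace σ)) h
    rw [himg, himg] at h'
    change (OrderDual.ofDual P).1.asIdeal ≤ (OrderDual.ofDual Q).1.asIdeal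
    rw [← hvan (OrderDual.ofDual P).1, ← hvan (OrderDual.ofDual Q).1]
    exact fun p hp => mem_vanishing.2 fun x hx => mem_vanishing.1 hp x (h' hx)

end AffSpace

/-! ### Monomial maps and toric varieties -/

/-- The homomorphism from a polynomial ring to the algebra of a commutative monoid that sends the
variables to the monomials with exponents `α`. -/
noncomputable def monomialHom {σ Γ : Type*} [AddCommMonoid Γ] (α : σ → Γ) :
    MvPolynomial σ ℂ →ₐ[ℂ] AddMonoidAlgebra ℂ Γ :=
  MvPolynomial.aeval fun i => AddMonoidAlgebra.single (α i) 1

section monomialHom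

variable {σ Γ Γ' Ω : Type*} [AddCommMonoid Γ] [AddCommMonoid Γ']

@[simp] theorem monomialHom_X (α : σ → Γ) (i : σ) :
    monomialHom α (MvPolynomial.X i) = AddMonoidAlgebra.single (α i) 1 :=
  MvPolynomial.aeval_X _ i

theorem ker_monomialHom_comp (α : σ → Γ) (ι : Γ →+ Γ') (hι : Function.Injective ι) :
    RingHom.ker (monomialHom fun i => ι (α i)) = RingHom.ker (monomialHom α) := by
  have h : monomialHom (fun i => ι (α i)) =
      (AddMonoidAlgebra.mapDomainAlgHom ℂ ℂ ι).comp (monomialHom α) := by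
    apply MvPolynomial.algHom_ext
    intro i
    simp [AddMonoidAlgebra.mapDomain_single]
  ext p
  rw [RingHom.mem_ker, RingHom.mem_ker, h]
  exact map_eq_zero_iff (AddMonoidAlgebra.mapDomainAlgHom ℂ ℂ ι)
    (AddMonoidAlgebra.mapDomain_injective hι)

theorem AddMonoidAlgebra.lift_injective_of_linearIndependent (e : Multiplicative Γ →* (Ω → ℂ))
    (he : LinearIndependent ℂ fun γ : Γ => e (Multiplicative.ofAdd γ)) :
    Function.Injective (AddMonoidAlgebra.lift ℂ (Ω → ℂ) Γ e) := by
  rw [linearIndependent_iff_injective_finsuppLinearCombination] at he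
  intro f g hfg
  rw [AddMonoidAlgebra.lift_apply, AddMonoidAlgebra.lift_apply] at hfg
  exact AddMonoidAlgebra.coeff_injective (he hfg)

/-- For points whose coordinates are members of a multiplicative, linearly independent family of
functions, the ideal of relations is the kernel of the corresponding monomial homomorphism. -/
theorem AffSpace.vanishing_range (e : Multiplicative Γ →* (Ω → ℂ))
    (he : LinearIndependent ℂ fun γ : Γ => e (Multiplicative.ofAdd γ)) (α : σ → Γ)
    (x : Ω → AffSpace σ) (hx : ∀ ω i, x ω i = e (Multiplicative.ofAdd (α i)) ω) :
    AffSpace.vanishing (Set.range x) = RingHom.ker (monomialHom α) := by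
  have key : ∀ p ω, AffSpace.evalAt (x ω) p =
      AddMonoidAlgebra.lift ℂ (Ω → ℂ) Γ e (monomialHom α p) ω := by
    intro p ω
    induction p using MvPolynomial.induction_on with
    | C a =>
      rw [AffSpace.evalAt_C, ← MvPolynomial.algebraMap_eq, AlgHom.commutes, AlgHom.commutes]
      rfl
    | add p q hp hq => rw [map_add, map_add, map_add, hp, hq, Pi.add_apply]
    | mul_X p i hp =>
      rw [map_mul, map_mul, map_mul, hp, Pi.mul_apply, AffSpace.evalAt_X, monomialHom_X,
        AddMonoidAlgebra.lift_single, one_smul, hx]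
  ext p
  rw [AffSpace.mem_vanishing, RingHom.mem_ker,
    ← map_eq_zero_iff _ (AddMonoidAlgebra.lift_injective_of_linearIndependent e he)]
  simp only [Set.forall_mem_range, key]
  exact ⟨fun h => funext h, fun h ω => congrFun h ω⟩

end monomialHom

/-- The elements of an algebra without zero divisors that are algebraic over a subalgebra are closed
under sums, products and inverses, so they contain all monomials as soon as the exponents `α`
generate the group. -/
theorem isAlgebraic_range_monomialHom {σ Γ : Type*} [AddCommGroup Γ]
    [IsDomain (AddMonoidAlgebra ℂ Γ)] (α : σ → Γ)
    (hα : AddSubgroup.closure (Set.range α) = ⊤) :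
    Algebra.IsAlgebraic (monomialHom α).range (AddMonoidAlgebra ℂ Γ) := by
  have hmon : ∀ γ : Γ, IsAlgebraic (monomialHom α).range
      (AddMonoidAlgebra.single γ 1 : AddMonoidAlgebra ℂ Γ) := by
    intro γ
    have hγ : γ ∈ AddSubgroup.closure (Set.range α) := by rw [hα]; trivial
    induction hγ using AddSubgroup.closure_induction with
    | mem x hx =>
      obtain ⟨i, rfl⟩ := hx
      exact isAlgebraic_algebraMap
        (⟨_, ⟨MvPolynomial.X i, monomialHom_X α i⟩⟩ : (monomialHom α).range)
    | zero => exact isAlgebraic_one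
    | add x y _ _ hx hy =>
      have := hx.mul hy
      rwa [AddMonoidAlgebra.single_mul_single, one_mul] at this
    | neg x _ hx =>
      let _ : Invertible (AddMonoidAlgebra.single x 1 : AddMonoidAlgebra ℂ Γ) :=
        ⟨AddMonoidAlgebra.single (-x) 1,
          by rw [AddMonoidAlgebra.single_mul_single, neg_add_cancel, one_mul]; rfl,
          by rw [AddMonoidAlgebra.single_mul_single, add_neg_cancel, one_mul]; rfl⟩
      exact hx.invOf
  refine ⟨fun f => ?_⟩
  induction f using AddMonoidAlgebra.induction_linear with
  | zero => exact isAlgebraic_zero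
  | add f g hf hg => exact hf.add hg
  | single γ c =>
    have : (AddMonoidAlgebra.single γ c : AddMonoidAlgebra ℂ Γ) =
        algebraMap (monomialHom α).range _ (algebraMap ℂ _ c) * AddMonoidAlgebra.single γ 1 := by
      rw [← IsScalarTower.algebraMap_apply, ← Algebra.smul_def, AddMonoidAlgebra.smul_single,
        smul_eq_mul, mul_one]
    rw [this]
    exact (isAlgebraic_algebraMap _).mul (hmon γ)

theorem trdeg_eq_trdeg_range_monomialHom {σ Γ : Type} [AddCommGroup Γ]
    [IsDomain (AddMonoidAlgebra ℂ Γ)] (α : σ → Γ)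
    (hα : AddSubgroup.closure (Set.range α) = ⊤) :
    Algebra.trdeg ℂ (AddMonoidAlgebra ℂ Γ) = Algebra.trdeg ℂ (monomialHom α).range := by
  have := isAlgebraic_range_monomialHom α hα
  have : FaithfulSMul ℂ (monomialHom α).range :=
    (faithfulSMul_iff_algebraMap_injective _ _).2 (algebraMap ℂ _).injective
  have : FaithfulSMul (monomialHom α).range (AddMonoidAlgebra ℂ Γ) :=
    (faithfulSMul_iff_algebraMap_injective _ _).2 Subtype.val_injective
  rw [← trdeg_add_eq ℂ (monomialHom α).range (A := AddMonoidAlgebra ℂ Γ),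
    trdeg_eq_zero (R := (monomialHom α).range),
    add_zero]

/-- The character of the torus with the given exponents, as a function on the torus. -/
def torusCharacter (r : ℕ) : Multiplicative (Fin r → ℤ) →* ((Fin r → ℂˣ) → ℂ) where
  toFun β x := ((∏ j, x j ^ (Multiplicative.toAdd β) j : ℂˣ) : ℂ)
  map_one' := by
    funext x
    simp
  map_mul' β γ := by
    funext x
    simp [zpow_add, Finset.prod_mul_distrib]

theorem linearIndependent_torusCharacter (r : ℕ) :
    LinearIndependent ℂ fun β : Fin r → ℤ => torusCharacter r (Multiplicative.ofAdd β) := by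
  let χ : (Fin r → ℤ) → ((Fin r → ℂˣ) →* ℂ) := fun β =>
    { toFun := fun x => ((∏ j, x j ^ β j : ℂˣ) : ℂ)
      map_one' := by simp
      map_mul' := fun x y => by simp [mul_zpow, Finset.prod_mul_distrib] }
  have hχ : Function.Injective χ := by
    intro β γ h
    funext j
    have h2 := DFunLike.congr_fun h (Pi.mulSingle j (Units.mk0 2 two_ne_zero))
    have h3 : ∀ δ : Fin r → ℤ, χ δ (Pi.mulSingle j (Units.mk0 2 two_ne_zero)) = (2 : ℂ) ^ δ j := by
      intro δ
      change ((∏ i, (Pi.mulSingle j (Units.mk0 2 two_ne_zero) : Fin r → ℂˣ) i ^ δ i : ℂˣ) : ℂ) = _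
      rw [Finset.prod_eq_single j]
      · simp
      · intro i _ hij
        rw [Pi.mulSingle_eq_of_ne hij, one_zpow]
      · simp
    rw [h3, h3] at h2
    have h4 : (((2 : ℝ) ^ β j : ℝ) : ℂ) = (((2 : ℝ) ^ γ j : ℝ) : ℂ) := by
      push_cast
      exact h2
    exact zpow_right_injective₀ (by norm_num) (by norm_num) (Complex.ofReal_injective h4)
  exact (linearIndependent_monoidHom (Fin r → ℂˣ) ℂ).comp χ hχ

/-- Laurent polynomials in `r` variables have transcendence degree `r`: they are algebraic over
the polynomials. -/
theorem trdeg_laurent (r : ℕ) : Algebra.trdeg ℂ (AddMonoidAlgebra ℂ (Fin r → ℤ)) = r := by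
  let α : Fin r → Fin r → ℤ := fun j => Pi.single j 1
  have hα : AddSubgroup.closure (Set.range α) = ⊤ := by
    refine eq_top_iff.2 fun β _ => ?_
    have : β = ∑ j, β j • α j := by
      funext i
      simp [α, Finset.sum_apply, Pi.single_apply]
    rw [this]
    exact sum_mem fun j _ => zsmul_mem (AddSubgroup.subset_closure (Set.mem_range_self j)) _
  have hinj : Function.Injective (monomialHom α) := by
    refine (injective_iff_map_eq_zero _).2 fun p hp => ?_
    have hp' : p ∈ RingHom.ker (monomialHom α) := hp
    -- the functions `x_j` on the torus satisfy no polynomial relation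
    rw [← AffSpace.vanishing_range (torusCharacter r) (linearIndependent_torusCharacter r) α
      (fun x j => (x j : ℂ)) (fun x j => ?_), AffSpace.mem_vanishing] at hp'
    · refine MvPolynomial.funext_set (fun _ => {0}ᶜ) (fun _ => Set.Finite.infinite_compl
        (Set.finite_singleton 0)) fun x hx => ?_
      rw [map_zero]
      exact hp' (show AffSpace (Fin r) from x)
        (Set.mem_range.2 ⟨fun j => Units.mk0 (x j) (hx j trivial), rfl⟩)
    · change (x j : ℂ) = ((∏ i, x i ^ (Pi.single j 1 : Fin r → ℤ) i : ℂˣ) : ℂ)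
      rw [Finset.prod_eq_single j]
      · simp
      · intro i _ hij
        rw [Pi.single_eq_of_ne hij, zpow_zero]
      · simp
  rw [trdeg_eq_trdeg_range_monomialHom α hα,
    ← (AlgEquiv.ofInjective (monomialHom α) hinj).trdeg_eq, MvPolynomial.trdeg_of_isDomain]
  simp

namespace AffSpace

variable {r m : ℕ} (α : Fin m → Fin r → ℤ)

theorem vanishing_range_monomialMap :
    vanishing (Set.range (monomialMap α)) = RingHom.ker (monomialHom α) :=
  vanishing_range (torusCharacter r) (linearIndependent_torusCharacter r) α _ fun _ _ => rfl

theorem isIrreducible_toricModel : IsIrreducible (toricModel α) := by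
  apply isIrreducible_closure
  rw [vanishing_range_monomialMap]
  exact RingHom.ker_isPrime _

/-- The coordinate ring is the algebra generated by the monomials with exponents `α`, over which
the Laurent polynomials are algebraic; so its transcendence degree is the dimension of the torus. -/
theorem topologicalKrullDim_toricModel (hα : AddSubgroup.closure (Set.range α) = ⊤) :
    topologicalKrullDim (toricModel α) = r := by
  rw [toricModel, topologicalKrullDim_closure, vanishing_range_monomialMap]
  have e := Ideal.quotientKerAlgEquivOfSurjective (monomialHom α).rangeRestrict_surjective
  rw [← AlgHom.ker_rangeRestrict, ringKrullDim_eq_of_ringEquiv e.toRingEquiv]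
  have : Algebra.FiniteType ℂ (monomialHom α).range :=
    Algebra.FiniteType.of_surjective _ (monomialHom α).rangeRestrict_surjective
  exact ringKrullDim_eq_of_trdeg_eq ℂ _ r
    ((trdeg_eq_trdeg_range_monomialHom α hα).symm.trans (trdeg_laurent r))

end AffSpace

/-! ### Exponential polynomials and linear recurrences -/

section ExponentialPolynomials

open Polynomial

/-- The shift operator on two-sided sequences. -/
def shift : Module.End ℂ (ℤ → ℂ) := LinearMap.funLeft ℂ ℂ (· + 1)

theorem shift_apply (f : ℤ → ℂ) (k : ℤ) : shift f k = f (k + 1) := rfl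

theorem shift_pow_apply (f : ℤ → ℂ) (i : ℕ) (k : ℤ) : (shift ^ i) f k = f (k + i) := by
  induction i generalizing k with
  | zero => simp
  | succ i ih =>
    rw [pow_succ', Module.End.mul_apply, shift_apply, ih]
    congr 1
    push_cast
    ring

theorem aeval_shift_apply (p : ℂ[X]) (f : ℤ → ℂ) (k : ℤ) :
    aeval shift p f k = ∑ i ∈ Finset.range (p.natDegree + 1), p.coeff i * f (k + i) := by
  rw [aeval_eq_sum_range, LinearMap.sum_apply, Finset.sum_apply]
  refine Finset.sum_congr rfl fun i _ => ?_
  rw [LinearMap.smul_apply, Pi.smul_apply, shift_pow_apply, smul_eq_mul]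

/-- A solution of a linear recurrence with nonzero constant coefficient is determined by its
initial values. -/
theorem eq_zero_of_aeval_shift_eq_zero {p : ℂ[X]} (hp : p ≠ 0) (hp0 : p.coeff 0 ≠ 0) {f : ℤ → ℂ}
    (hf : aeval shift p f = 0) (h0 : ∀ i < p.natDegree, f (i : ℕ) = 0) : f = 0 := by
  have hrec : ∀ k : ℤ, ∑ i ∈ Finset.range (p.natDegree + 1), p.coeff i * f (k + i) = 0 := by
    intro k
    rw [← aeval_shift_apply, hf, Pi.zero_apply]
  -- `d` consecutive zeros propagate forwards by the leading coefficient, and backwards by the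
  -- constant coefficient
  have hlead : ∀ k : ℤ, (∀ i < p.natDegree, f (k + (i : ℕ)) = 0) → f (k + p.natDegree) = 0 := by
    intro k hk
    have h := hrec k
    rw [Finset.sum_range_succ, Finset.sum_eq_zero, zero_add] at h
    · exact (mul_eq_zero.1 h).resolve_left (by simpa using hp)
    · intro i hi
      rw [hk i (Finset.mem_range.1 hi), mul_zero]
  have hall : ∀ k : ℤ, ∀ i < p.natDegree, f (k + (i : ℕ)) = 0 := by
    intro k
    induction k using Int.induction_on with
    | zero => simpa using h0
    | succ k ih =>
      intro i hi
      rcases Nat.lt_or_ge (i + 1) p.natDegree with h | h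
      · have := ih (i + 1) h
        rwa [show (k : ℤ) + 1 + i = k + (i + 1 : ℕ) by push_cast; ring]
      · have := hlead _ ih
        rwa [show (k : ℤ) + 1 + i = k + p.natDegree by
          rw [show p.natDegree = i + 1 by omega]; push_cast; ring]
    | pred k ih =>
      intro i hi
      rcases i with _ | i
      · have h := hrec (-k - 1)
        rw [Finset.sum_range_succ', Finset.sum_eq_zero, zero_add] at h
        · exact (mul_eq_zero.1 h).resolve_left hp0
        · intro i hi
          have := ih i (Finset.mem_range.1 hi)
          rw [show (-k - 1 + (i + 1 : ℕ) : ℤ) = -k + i by push_cast; ring, this, mul_zero]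
      · have := ih i (by omega)
        rwa [show (-k - 1 + (i + 1 : ℕ) : ℤ) = -k + i by push_cast; ring]
  funext k
  have := hlead (k - p.natDegree) (hall _)
  rwa [sub_add_cancel] at this

/-- The exponential polynomial `k ↦ q(k) λ^k`. -/
noncomputable def expPoly (l : ℂˣ) : ℂ[X] →ₗ[ℂ] (ℤ → ℂ) where
  toFun q k := q.eval (k : ℂ) * ((l ^ k : ℂˣ) : ℂ)
  map_add' p q := by
    funext k
    simp [add_mul]
  map_smul' c q := by
    funext k
    simp [mul_assoc]

theorem expPoly_apply (l : ℂˣ) (q : ℂ[X]) (k : ℤ) :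
    expPoly l q k = q.eval (k : ℂ) * ((l ^ k : ℂˣ) : ℂ) := rfl

theorem expPoly_injective (l : ℂˣ) : Function.Injective (expPoly l) := by
  refine (injective_iff_map_eq_zero _).2 fun q hq => ?_
  refine Polynomial.eq_zero_of_infinite_isRoot q
    (Set.Infinite.mono ?_ (Set.infinite_range_of_injective (Int.cast_injective (α := ℂ))))
  rintro _ ⟨k, rfl⟩
  have := congrFun hq k
  exact (mul_eq_zero.1 this).resolve_right (Units.ne_zero _)

theorem shift_sub_expPoly (l : ℂˣ) (q : ℂ[X]) :
    (shift - algebraMap ℂ (Module.End ℂ (ℤ → ℂ)) l) (expPoly l q) =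
      expPoly l ((l : ℂ) • (taylor 1 q - q)) := by
  funext k
  have h1 : (shift - algebraMap ℂ (Module.End ℂ (ℤ → ℂ)) l) (expPoly l q) k =
    expPoly l q (k + 1) - l * expPoly l q k := rfl
  rw [h1, expPoly_apply, expPoly_apply, expPoly_apply, eval_smul, eval_sub, taylor_eval,
    zpow_add_one, smul_eq_mul]
  push_cast
  ring

/-- The operator `shift - λ` lowers the degree of the polynomial in `q(k) λ^k`. -/
theorem shift_sub_pow_expPoly (l : ℂˣ) (m : ℕ) (q : ℂ[X]) (hq : q.degree < m) :
    ((shift - algebraMap ℂ (Module.End ℂ (ℤ → ℂ)) l) ^ m) (expPoly l q) = 0 := by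
  induction m generalizing q with
  | zero =>
    have : q = 0 := by simpa using hq
    simp [this]
  | succ m ih =>
    rw [pow_succ, Module.End.mul_apply, shift_sub_expPoly]
    apply ih
    by_cases h0 : q = 0
    · simp only [h0, map_zero, sub_self, smul_zero, degree_zero]
      exact WithBot.bot_lt_coe _
    refine (degree_smul_le _ _).trans_lt ?_
    have h1 : (taylor 1 q - q).degree < (taylor 1 q).degree :=
      degree_sub_lt_left (degree_taylor q 1) ((taylor_eq_zero 1 q).not.2 h0) (leadingCoeff_taylor 1 q)
    rw [degree_taylor] at h1
    have h2 : q.degree ≤ m := by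
      rw [degree_eq_natDegree h0] at hq ⊢
      exact_mod_cast Nat.lt_succ_iff.1 (by exact_mod_cast hq)
    exact h1.trans_le h2

theorem expPoly_mem_maxGenEigenspace (l : ℂˣ) (q : ℂ[X]) :
    expPoly l q ∈ Module.End.maxGenEigenspace shift (l : ℂ) := by
  rw [Module.End.mem_maxGenEigenspace]
  refine ⟨q.natDegree + 1, shift_sub_pow_expPoly l _ q ?_⟩
  exact degree_le_natDegree.trans_lt (by exact_mod_cast Nat.lt_succ_self _)

/-- The functions `k ↦ k^j λ^k` are linearly independent: for different `λ` they lie in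
different generalized eigenspaces of the shift. -/
theorem linearIndependent_expPoly :
    LinearIndependent ℂ fun x : ℂˣ × ℕ => expPoly x.1 (X ^ x.2) := by
  classical
  rw [linearIndependent_iff']
  intro s g hg x hx
  have hind := (Module.End.independent_maxGenEigenspace shift).comp
    (Units.val_injective (α := ℂ))
  rw [iSupIndep_iff_finsetSum_eq_zero_imp_eq_zero] at hind
  let q : ℂˣ → ℂ[X] := fun l => ∑ y ∈ s with y.1 = l, g y • X ^ y.2
  have hq : ∀ l, expPoly l (q l) = ∑ y ∈ s with y.1 = l, g y • expPoly y.1 (X ^ y.2) := by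
    intro l
    rw [map_sum]
    refine Finset.sum_congr rfl fun y hy => ?_
    rw [map_smul, (Finset.mem_filter.1 hy).2]
  have hsum : ∑ l ∈ s.image Prod.fst, expPoly l (q l) = 0 := by
    simp_rw [hq]
    rw [Finset.sum_fiberwise_of_maps_to fun y hy => Finset.mem_image_of_mem _ hy]
    exact hg
  have h0 := hind (s.image Prod.fst) (fun l => expPoly l (q l))
    (fun l _ => expPoly_mem_maxGenEigenspace l _) hsum x.1 (Finset.mem_image_of_mem _ hx)
  have h1 : q x.1 = 0 := expPoly_injective x.1 (by simpa using h0)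
  have h2 : (q x.1).coeff x.2 = g x := by
    rw [finsetSum_coeff, Finset.sum_eq_single x]
    · simp
    · intro y hy hyx
      have : x.2 ≠ y.2 := fun h => hyx (Prod.ext (Finset.mem_filter.1 hy).2 h.symm)
      simp [coeff_X_pow, this]
    · intro h
      exact (h (Finset.mem_filter.2 ⟨hx, rfl⟩)).elim
  rw [← h2, h1, coeff_zero]

section Recurrence

variable {p : ℂ[X]}

theorem ne_zero_of_mem_roots_toType (hp0 : p.coeff 0 ≠ 0) (x : p.roots.ToType) :
    (x.1 : ℂ) ≠ 0 := by
  intro h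
  have h1 : x.1 ∈ p.roots := Multiset.coe_mem
  rw [h] at h1
  exact hp0 (by rw [coeff_zero_eq_eval_zero]; exact isRoot_of_mem_roots h1)

/-- The functions `k ↦ k^j λ^k`, for the roots `λ` of `p` and `j` less than the multiplicity of
`λ`, form a basis of the solutions of the recurrence with characteristic polynomial `p`. -/
theorem span_expPoly_roots (hp : p ≠ 0) (hp0 : p.coeff 0 ≠ 0) :
    Submodule.span ℂ (Set.range fun x : p.roots.ToType =>
      expPoly (Units.mk0 x.1 (ne_zero_of_mem_roots_toType hp0 x)) (X ^ (x.2 : ℕ))) =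
      LinearMap.ker (aeval shift p) := by
  set V := LinearMap.ker (aeval shift p) with hV
  have hmem : ∀ x : p.roots.ToType,
      expPoly (Units.mk0 x.1 (ne_zero_of_mem_roots_toType hp0 x)) (X ^ (x.2 : ℕ)) ∈ V := by
    intro x
    obtain ⟨q, hq⟩ := pow_rootMultiplicity_dvd p x.1
    have hq' := congrArg (aeval shift) hq
    rw [mul_comm, map_mul, map_pow, map_sub, aeval_X, aeval_C] at hq'
    rw [hV, LinearMap.mem_ker, hq', Module.End.mul_apply]
    have := shift_sub_pow_expPoly (Units.mk0 x.1 (ne_zero_of_mem_roots_toType hp0 x))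
      (p.rootMultiplicity x.1) (X ^ (x.2 : ℕ)) (by
        rw [degree_X_pow]
        exact_mod_cast x.2.2.trans_eq (count_roots p))
    rw [Units.val_mk0] at this
    rw [this, map_zero]
  -- the initial values embed the solutions into a space of dimension `p.natDegree`, which is the
  -- number of the functions in question
  let res : V →ₗ[ℂ] (Fin p.natDegree → ℂ) :=
    { toFun := fun f i => (f : ℤ → ℂ) (i : ℕ)
      map_add' := fun _ _ => rfl
      map_smul' := fun _ _ => rfl }
  have hres : Function.Injective res := by
    refine (injective_iff_map_eq_zero _).2 fun f hf => Subtype.ext ?_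
    exact eq_zero_of_aeval_shift_eq_zero hp hp0 f.2 fun i hi => congrFun hf ⟨i, hi⟩
  have : Module.Finite ℂ V := Module.Finite.of_injective res hres
  have hle : Module.finrank ℂ V ≤ p.natDegree := by
    simpa using LinearMap.finrank_le_finrank_of_injective hres
  let v : p.roots.ToType → V := fun x => ⟨_, hmem x⟩
  have hv : LinearIndependent ℂ v := by
    apply LinearIndependent.of_comp V.subtype
    refine linearIndependent_expPoly.comp (fun x : p.roots.ToType =>
      (Units.mk0 x.1 (ne_zero_of_mem_roots_toType hp0 x), (x.2 : ℕ))) ?_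
    rintro ⟨x, i⟩ ⟨y, j⟩ h
    rw [Prod.mk.injEq] at h
    obtain ⟨h1, h2⟩ := h
    have h1 : x = y := congrArg Units.val h1
    subst h1
    have h2 : i = j := Fin.ext h2
    rw [h2]
  have hcard : Fintype.card p.roots.ToType = p.natDegree := by
    rw [Multiset.card_coe, IsAlgClosed.card_roots_eq_natDegree]
  have hspan := hv.span_eq_top_of_card_eq_finrank'
    (le_antisymm hv.fintype_card_le_finrank (hcard ▸ hle))
  have := congrArg (Submodule.map V.subtype) hspan
  rw [Submodule.map_span, Submodule.map_top, Submodule.range_subtype, ← Set.range_comp] at this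
  exact this

end Recurrence

end ExponentialPolynomials

/-! ### Powers of a matrix and its minimal polynomial -/

section MatrixPowers

open Polynomial

variable {n : ℕ}

/-- The point of affine space given by a power of `M`. -/
def powPoint (M : GL (Fin n) ℂ) (k : ℤ) : AffSpace (Fin n × Fin n) :=
  Matrix.toAff ((M ^ k : GL (Fin n) ℂ) : Matrix (Fin n) (Fin n) ℂ)

theorem minpoly_coeff_zero_ne_zero (M : GL (Fin n) ℂ) :
    (minpoly ℂ (M : Matrix (Fin n) (Fin n) ℂ)).coeff 0 ≠ 0 := by
  rw [← Matrix.minpoly_toLin']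
  apply LinearMap.minpoly_coeff_zero_of_injective
  exact Matrix.mulVec_injective_of_isUnit M.isUnit

theorem minpoly_matrix_ne_zero (A : Matrix (Fin n) (Fin n) ℂ) : minpoly ℂ A ≠ 0 :=
  minpoly.ne_zero (Algebra.IsIntegral.isIntegral A)

theorem hasEigenvalue_toLin'_iff (A : Matrix (Fin n) (Fin n) ℂ) (c : ℂ) :
    Module.End.HasEigenvalue (Matrix.toLin' A) c ↔ c ∈ (minpoly ℂ A).roots := by
  rw [Module.End.hasEigenvalue_iff_isRoot, Matrix.minpoly_toLin',
    mem_roots (minpoly_matrix_ne_zero A)]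

theorem aeval_shift_dual (M : GL (Fin n) ℂ) (φ : Module.Dual ℂ (Matrix (Fin n) (Fin n) ℂ))
    (p : ℂ[X]) (k : ℤ) :
    aeval shift p (fun k => φ ((M ^ k : GL (Fin n) ℂ) : Matrix (Fin n) (Fin n) ℂ)) k =
      φ (((M ^ k : GL (Fin n) ℂ) : Matrix (Fin n) (Fin n) ℂ) *
        aeval (M : Matrix (Fin n) (Fin n) ℂ) p) := by
  rw [aeval_shift_apply, aeval_eq_sum_range, Finset.mul_sum, map_sum]
  refine Finset.sum_congr rfl fun i _ => ?_
  rw [mul_smul_comm, map_smul, smul_eq_mul, zpow_add, zpow_natCast, Units.val_mul,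
    Units.val_pow_eq_pow_val]

theorem dual_pow_mem_ker (M : GL (Fin n) ℂ) (φ : Module.Dual ℂ (Matrix (Fin n) (Fin n) ℂ)) :
    (fun k : ℤ => φ ((M ^ k : GL (Fin n) ℂ) : Matrix (Fin n) (Fin n) ℂ)) ∈
      LinearMap.ker (aeval shift (minpoly ℂ (M : Matrix (Fin n) (Fin n) ℂ))) := by
  rw [LinearMap.mem_ker]
  funext k
  rw [aeval_shift_dual, minpoly.aeval, mul_zero, map_zero]
  rfl

/-- Every solution of the recurrence given by the minimal polynomial of `M` is a linear
functional of the powers of `M`. -/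
theorem exists_dual_of_mem_ker (M : GL (Fin n) ℂ) {f : ℤ → ℂ}
    (hf : f ∈ LinearMap.ker (aeval shift (minpoly ℂ (M : Matrix (Fin n) (Fin n) ℂ)))) :
    ∃ φ : Module.Dual ℂ (Matrix (Fin n) (Fin n) ℂ),
      ∀ k : ℤ, f k = φ ((M ^ k : GL (Fin n) ℂ) : Matrix (Fin n) (Fin n) ℂ) := by
  let ψ : Module.Dual ℂ ℂ[X] :=
    { toFun := fun q => aeval shift q f 0
      map_add' := fun p q => by simp
      map_smul' := fun c q => by simp }
  -- the functional `X^i ↦ f i` vanishes on the multiples of the minimal polynomial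
  have hψ : ψ ∈ LinearMap.range
      (aeval (R := ℂ) (M : Matrix (Fin n) (Fin n) ℂ)).toLinearMap.dualMap := by
    rw [LinearMap.range_dualMap_eq_dualAnnihilator_ker, Submodule.mem_dualAnnihilator]
    intro q hq
    obtain ⟨s, rfl⟩ := minpoly.dvd ℂ (M : Matrix (Fin n) (Fin n) ℂ) hq
    change aeval shift (_ * s) f 0 = 0
    rw [mul_comm, map_mul, Module.End.mul_apply, LinearMap.mem_ker.1 hf, map_zero]
    rfl
  obtain ⟨φ, hφ⟩ := hψ
  have hφ' : ∀ q : ℂ[X], φ (aeval (M : Matrix (Fin n) (Fin n) ℂ) q) = aeval shift q f 0 :=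
    fun q => LinearMap.congr_fun hφ q
  refine ⟨φ, fun k => sub_eq_zero.1 ?_⟩
  have h0 := eq_zero_of_aeval_shift_eq_zero (minpoly_matrix_ne_zero _)
    (minpoly_coeff_zero_ne_zero M)
    (LinearMap.mem_ker.1 (Submodule.sub_mem _ hf (dual_pow_mem_ker M φ))) fun i _ => by
      have := hφ' (X ^ i)
      rw [aeval_X_pow, aeval_X_pow, shift_pow_apply, zero_add] at this
      rw [Pi.sub_apply, zpow_natCast, Units.val_pow_eq_pow_val, this, sub_self]
  exact congrFun h0 k

end MatrixPowers

section Diagonalizable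

open Polynomial

variable {n : ℕ}

/-- The minimal polynomial divides the product of `X - c` over the distinct diagonal entries `c`. -/
theorem Matrix.IsDiagonalizable.nodup_roots {A : Matrix (Fin n) (Fin n) ℂ}
    (h : A.IsDiagonalizable) : (minpoly ℂ A).roots.Nodup := by
  classical
  obtain ⟨P, d, rfl⟩ := h
  set q : ℂ[X] := ∏ c ∈ Finset.univ.image d, (X - C c) with hq
  have hq0 : q ≠ 0 := Finset.prod_ne_zero_iff.2 fun c _ => X_sub_C_ne_zero c
  have hconj : ∀ p : ℂ[X], aeval ((P : Matrix (Fin n) (Fin n) ℂ) * Matrix.diagonal d *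
      ((P⁻¹ : GL (Fin n) ℂ) : Matrix (Fin n) (Fin n) ℂ)) p =
      (P : Matrix (Fin n) (Fin n) ℂ) * Matrix.diagonal (fun i => p.eval (d i)) *
      ((P⁻¹ : GL (Fin n) ℂ) : Matrix (Fin n) (Fin n) ℂ) := by
    intro p
    induction p using Polynomial.induction_on' with
    | add p q hp hq =>
      rw [map_add, hp, hq, ← add_mul, ← mul_add, Matrix.diagonal_add]
      simp
    | monomial k a =>
      rw [aeval_monomial, Units.conj_pow P, Matrix.diagonal_pow, Algebra.algebraMap_eq_smul_one,
        smul_mul_assoc, one_mul]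
      simp only [eval_monomial]
      have : (Matrix.diagonal fun i => a * d i ^ k) = a • Matrix.diagonal (d ^ k) := by
        rw [← Matrix.diagonal_smul]
        rfl
      rw [this, mul_smul_comm, smul_mul_assoc]
  have hdvd : minpoly ℂ ((P : Matrix (Fin n) (Fin n) ℂ) * Matrix.diagonal d *
      ((P⁻¹ : GL (Fin n) ℂ) : Matrix (Fin n) (Fin n) ℂ)) ∣ q := by
    apply minpoly.dvd
    rw [hconj]
    have : (fun i => q.eval (d i)) = 0 := by
      funext i
      rw [hq, eval_prod]
      exact Finset.prod_eq_zero (Finset.mem_image_of_mem d (Finset.mem_univ i)) (by simp)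
    rw [this, Matrix.diagonal_zero', mul_zero, zero_mul]
  refine Multiset.nodup_of_le (roots.le_of_dvd hq0 hdvd) ?_
  rw [hq, roots_prod_X_sub_C]
  exact Finset.nodup _

/-- A matrix with squarefree minimal polynomial is semisimple, so its eigenvectors span, and a basis
can be chosen among them. -/
theorem Matrix.isDiagonalizable_of_nodup_roots {A : Matrix (Fin n) (Fin n) ℂ}
    (h : (minpoly ℂ A).roots.Nodup) : A.IsDiagonalizable := by
  have hsep := (nodup_roots_iff_of_splits (minpoly_matrix_ne_zero A)
    (IsAlgClosed.splits _)).1 h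
  have hss : Module.End.IsSemisimple (Matrix.toLin' A) := by
    apply Module.End.isSemisimple_of_squarefree_aeval_eq_zero hsep.squarefree
    rw [← Matrix.minpoly_toLin', minpoly.aeval]
  have htop := hss.iSup_eigenspace_eq_top
  have hspan : ⊤ ≤ Submodule.span ℂ {v : Fin n → ℂ | ∃ c : ℂ, A.mulVec v = c • v} := by
    rw [← htop, iSup_le_iff]
    intro c v hv
    exact Submodule.subset_span ⟨c, Module.End.mem_eigenspace_iff.1 hv⟩
  let b₀ := Module.Basis.ofSpan hspan
  let b := b₀.reindex (b₀.indexEquiv (Pi.basisFun ℂ (Fin n)))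
  have hb : ∀ i, ∃ c : ℂ, A.mulVec (b i) = c • b i := by
    intro i
    rw [Module.Basis.reindex_apply]
    exact Module.Basis.ofSpan_subset hspan ⟨_, rfl⟩
  choose d hd using hb
  let P : GL (Fin n) ℂ := ⟨(Pi.basisFun ℂ (Fin n)).toMatrix b, b.toMatrix (Pi.basisFun ℂ (Fin n)),
    Module.Basis.toMatrix_mul_toMatrix_flip _ _, Module.Basis.toMatrix_mul_toMatrix_flip _ _⟩
  refine ⟨P, d, ?_⟩
  have hP : ∀ i j, (P : Matrix (Fin n) (Fin n) ℂ) i j = b j i := fun i j => rfl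
  have : A * (P : Matrix (Fin n) (Fin n) ℂ) =
      (P : Matrix (Fin n) (Fin n) ℂ) * Matrix.diagonal d := by
    ext i j
    rw [Matrix.mul_diagonal, Matrix.mul_apply, hP]
    have := congrFun (hd j) i
    rw [Pi.smul_apply, smul_eq_mul, mul_comm] at this
    exact this
  rw [← this, Matrix.mul_assoc, ← Units.val_mul, mul_inv_cancel, Units.val_one, mul_one]

end Diagonalizable

/-! ### Exponents of a finite set of units -/

section Lattice

theorem moduleFinite_closure {H : Type*} [CommGroup H] (S : Set H) (hS : S.Finite) :
    Module.Finite ℤ (Additive (Subgroup.closure S)) := by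
  have : Group.FG (Subgroup.closure S) :=
    (Group.fg_iff_subgroup_fg _).2 ((Subgroup.fg_iff _).2 ⟨S, rfl, hS⟩)
  exact Module.Finite.iff_addGroup_fg.2 inferInstance

theorem finite_torsion_closure {H : Type*} [CommGroup H] (S : Set H) (hS : S.Finite) :
    Finite (CommGroup.torsion (Subgroup.closure S)) := by
  have := moduleFinite_closure S hS
  have : Finite (Submodule.torsion ℤ (Additive (Subgroup.closure S))) :=
    Module.finite_of_fg_torsion _ (Submodule.torsion_isTorsion)
  have hmem : ∀ x : CommGroup.torsion (Subgroup.closure S),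
      Additive.ofMul (x : Subgroup.closure S) ∈
        Submodule.torsion ℤ (Additive (Subgroup.closure S)) := by
    intro x
    rw [← Submodule.mem_toAddSubgroup, Submodule.torsion_int]
    exact x.2
  refine Finite.of_injective (fun x : CommGroup.torsion (Subgroup.closure S) =>
    (⟨_, hmem x⟩ : Submodule.torsion ℤ (Additive (Subgroup.closure S)))) fun x y h => ?_
  exact Subtype.ext (congrArg (fun z : Submodule.torsion ℤ (Additive (Subgroup.closure S)) =>
    Additive.toMul (z : Additive (Subgroup.closure S))) h)

/-- The elements of a finite set `S` of units become, after raising them to the order `N` of the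
torsion, monomials in a multiplicatively independent family `b`, whose exponents generate the
lattice. -/
theorem exists_exponents (S : Set ℂˣ) (hS : S.Finite)
    [Finite (CommGroup.torsion (Subgroup.closure S))] :
    ∃ (b : Fin (groupRank (Subgroup.closure S)) → ℂˣ)
      (α : S → Fin (groupRank (Subgroup.closure S)) → ℤ),
      (∀ u : S, (u : ℂˣ) ^ Nat.card (CommGroup.torsion (Subgroup.closure S)) =
        ∏ j, b j ^ α u j) ∧
      AddSubgroup.closure (Set.range α) = ⊤ ∧
      ∀ β : Fin (groupRank (Subgroup.closure S)) → ℤ, ∏ j, b j ^ β j = 1 → β = 0 := by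
  set G := Subgroup.closure S with hG
  set N := Nat.card (CommGroup.torsion G) with hN
  have hN0 : N ≠ 0 := Nat.card_pos.ne'
  have : Module.Finite ℤ (Additive G) := moduleFinite_closure S hS
  let T := Submodule.torsion ℤ (Additive G)
  have hT : ∀ x ∈ T, N • x = 0 := by
    intro x hx
    have h1 : x ∈ AddCommGroup.torsion (Additive G) := by
      rw [← Submodule.torsion_int]
      exact hx
    have h2 : x.toMul ∈ CommGroup.torsion G := h1
    have h3 : (⟨x.toMul, h2⟩ : CommGroup.torsion G) ^ N = 1 := pow_card_eq_one'
    exact congrArg (fun y : CommGroup.torsion G => Additive.ofMul (y : G)) h3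
  have hfin : Module.finrank ℤ (Additive G ⧸ T) = groupRank G :=
    finrank_quotient_eq_of_le_torsion le_rfl
  -- the quotient by the torsion is free, of the same rank; lift a basis of it to `τ`
  let B := (Module.finBasis ℤ (Additive G ⧸ T)).reindex (finCongr hfin)
  choose τ hτ using fun j => T.mkQ_surjective (B j)
  let f : Additive G →+ (Fin (groupRank G) → ℤ) :=
    (B.equivFun.toLinearMap.comp T.mkQ).toAddMonoidHom
  have hf : ∀ x, f x = B.equivFun (T.mkQ x) := fun x => rfl
  have hfsurj : Function.Surjective f := B.equivFun.surjective.comp T.mkQ_surjective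
  let v : S → G := fun u => ⟨u, Subgroup.subset_closure u.2⟩
  have hval : ∀ β : Fin (groupRank G) → ℤ,
      (((N • ∑ j, β j • τ j : Additive G).toMul : G) : ℂˣ) =
        ∏ j, ((((τ j).toMul : G) : ℂˣ) ^ N) ^ β j := by
    intro β
    rw [toMul_nsmul, toMul_sum, Subgroup.coe_pow, SubmonoidClass.coe_finsetProd, ← Finset.prod_pow]
    refine Finset.prod_congr rfl fun j _ => ?_
    rw [toMul_zsmul, Subgroup.coe_zpow, ← zpow_natCast, ← zpow_natCast, ← zpow_mul, ← zpow_mul,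
      mul_comm]
  have hfτ : ∀ β : Fin (groupRank G) → ℤ, f (∑ j, β j • τ j) = β := by
    intro β
    rw [hf, map_sum]
    simp_rw [map_smul, hτ]
    rw [← B.equivFun_symm_apply, LinearEquiv.apply_symm_apply]
  refine ⟨fun j => (((τ j).toMul : G) : ℂˣ) ^ N, fun u => f (Additive.ofMul (v u)), ?_, ?_, ?_⟩
  · intro u
    rw [← hval]
    -- the difference of `u` and its free part is torsion, hence killed by `N`
    have hmem : Additive.ofMul (v u) - ∑ j, f (Additive.ofMul (v u)) j • τ j ∈ T := by
      rw [← Submodule.Quotient.mk_eq_zero, ← Submodule.mkQ_apply]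
      apply B.equivFun.injective
      rw [← hf, map_sub, hfτ, sub_self, map_zero]
    have h := hT _ hmem
    rw [nsmul_sub, sub_eq_zero] at h
    rw [← h]
    rfl
  · refine eq_top_iff.2 fun β _ => ?_
    obtain ⟨x, rfl⟩ := hfsurj β
    have key : ∀ g (hg : g ∈ Subgroup.closure S), f (Additive.ofMul (⟨g, hg⟩ : G)) ∈
        AddSubgroup.closure (Set.range fun u : S => f (Additive.ofMul (v u))) := by
      intro g hg
      induction hg using Subgroup.closure_induction with
      | mem x hx => exact AddSubgroup.subset_closure ⟨⟨x, hx⟩, rfl⟩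
      | one => exact (map_zero f).symm ▸ zero_mem _
      | mul x y hx hy h1 h2 =>
        have := add_mem h1 h2
        rwa [← map_add] at this
      | inv x hx h1 =>
        have := neg_mem h1
        rwa [← map_neg] at this
    exact key _ x.toMul.2
  · intro β hβ
    rw [← hval] at hβ
    have h1 : (N • ∑ j, β j • τ j : Additive G) = 0 := by
      apply Additive.toMul.injective
      exact Subtype.ext hβ
    have h2 := congrArg f h1
    rw [map_nsmul, hfτ, map_zero] at h2
    exact (smul_eq_zero.1 h2).resolve_left hN0

end Lattice

/-! ### Coordinates for the powers of a matrix -/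

section Coordinates

open Polynomial

variable {n : ℕ}

/-- The linear polynomial, in the coordinates of the space of matrices, of a linear functional. -/
noncomputable def linearPoly (φ : Module.Dual ℂ (Matrix (Fin n) (Fin n) ℂ)) :
    MvPolynomial (Fin n × Fin n) ℂ :=
  ∑ q, MvPolynomial.C (φ (Matrix.single q.1 q.2 1)) * MvPolynomial.X q

theorem evalAt_linearPoly (φ : Module.Dual ℂ (Matrix (Fin n) (Fin n) ℂ))
    (A : Matrix (Fin n) (Fin n) ℂ) : AffSpace.evalAt A.toAff (linearPoly φ) = φ A := by
  conv_rhs => rw [Matrix.matrix_eq_sum_single A]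
  rw [linearPoly, map_sum, map_sum, Fintype.sum_prod_type]
  refine Finset.sum_congr rfl fun i _ => ?_
  rw [map_sum]
  refine Finset.sum_congr rfl fun j _ => ?_
  have : Matrix.single i j (A i j) = A i j • Matrix.single i j (1 : ℂ) := by
    rw [Matrix.smul_single, smul_eq_mul, mul_one]
  rw [map_mul, AffSpace.evalAt_C, AffSpace.evalAt_X, this, map_smul, smul_eq_mul, mul_comm]
  rfl

/-- Translating the exponents of the powers of `M` is the restriction of the linear isomorphism
given by multiplication by a power of `M`. -/
theorem isomorphic_powPoint_add (M : GL (Fin n) ℂ) (K : Set ℤ) (a : ℤ) :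
    AffSpace.Isomorphic (powPoint M '' K) ((fun k => powPoint M (a + k)) '' K) := by
  let F : ℤ → Fin n × Fin n → MvPolynomial (Fin n × Fin n) ℂ := fun a q =>
    linearPoly ((Matrix.entryLinearMap ℂ ℂ q.1 q.2).comp
      (LinearMap.mulLeft ℂ ((M ^ a : GL (Fin n) ℂ) : Matrix (Fin n) (Fin n) ℂ)))
  have hF : ∀ a k, AffSpace.polyMap (F a) (powPoint M k) = powPoint M (a + k) := by
    intro a k
    funext q
    refine (evalAt_linearPoly _ _).trans ?_
    change (((M ^ a : GL (Fin n) ℂ) : Matrix (Fin n) (Fin n) ℂ) *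
      ((M ^ k : GL (Fin n) ℂ) : Matrix (Fin n) (Fin n) ℂ)) q.1 q.2 = _
    rw [← Units.val_mul, ← zpow_add]
    rfl
  refine ⟨F a, F (-a), ?_, ?_⟩
  · rintro _ ⟨k, hk, rfl⟩
    rw [hF, hF, neg_add_cancel_left]
    exact ⟨⟨k, hk, rfl⟩, rfl⟩
  · rintro _ ⟨k, hk, rfl⟩
    simp only
    rw [hF, neg_add_cancel_left, hF]
    exact ⟨⟨k, hk, rfl⟩, rfl⟩

/-- The roots of the minimal polynomial of `M`, as units. -/
noncomputable def rootUnit (M : GL (Fin n) ℂ)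
    (x : (minpoly ℂ (M : Matrix (Fin n) (Fin n) ℂ)).roots.ToType) : ℂˣ :=
  Units.mk0 x.1 (ne_zero_of_mem_roots_toType (minpoly_coeff_zero_ne_zero M) x)

theorem exists_dual_expPoly (M : GL (Fin n) ℂ)
    (x : (minpoly ℂ (M : Matrix (Fin n) (Fin n) ℂ)).roots.ToType) :
    ∃ φ : Module.Dual ℂ (Matrix (Fin n) (Fin n) ℂ), ∀ k : ℤ,
      expPoly (rootUnit M x) (X ^ (x.2 : ℕ)) k =
        φ ((M ^ k : GL (Fin n) ℂ) : Matrix (Fin n) (Fin n) ℂ) := by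
  apply exists_dual_of_mem_ker
  rw [← span_expPoly_roots (minpoly_matrix_ne_zero _) (minpoly_coeff_zero_ne_zero M)]
  exact Submodule.subset_span ⟨x, rfl⟩

/-- In suitable linear coordinates, the powers of `M` are the points with coordinates
`k^j λ^k`, for the eigenvalues `λ` and `j` less than the multiplicity of `λ` in the minimal
polynomial. -/
theorem isomorphic_powPoint_expPoly (M : GL (Fin n) ℂ) (K : Set ℤ) {ι : Type*} [Fintype ι]
    (e : ι ≃ (minpoly ℂ (M : Matrix (Fin n) (Fin n) ℂ)).roots.ToType) :
    AffSpace.Isomorphic (powPoint M '' K)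
      ((fun (k : ℤ) (t : ι) => expPoly (rootUnit M (e t)) (X ^ ((e t).2 : ℕ)) k :
        ℤ → AffSpace ι) '' K) := by
  choose φ hφ using fun t => exists_dual_expPoly M (e t)
  have hentry : ∀ q : Fin n × Fin n, ∃ c : ι → ℂ, ∀ k : ℤ, powPoint M k q =
      ∑ t, c t * expPoly (rootUnit M (e t)) (X ^ ((e t).2 : ℕ)) k := by
    intro q
    have h := dual_pow_mem_ker M (Matrix.entryLinearMap ℂ ℂ q.1 q.2)
    rw [← span_expPoly_roots (minpoly_matrix_ne_zero _) (minpoly_coeff_zero_ne_zero M),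
      Submodule.mem_span_range_iff_exists_fun] at h
    obtain ⟨c, hc⟩ := h
    refine ⟨fun t => c (e t), fun k => ?_⟩
    have h := congrFun hc k
    rw [Finset.sum_apply] at h
    rw [e.sum_comp fun x => c x * expPoly (rootUnit M x) (X ^ (x.2 : ℕ)) k]
    exact h.symm
  choose c hc using hentry
  let y : ℤ → AffSpace ι := fun k t => expPoly (rootUnit M (e t)) (X ^ ((e t).2 : ℕ)) k
  -- the inverse change of coordinates, read off from the expansion of the matrix entries
  let G : Fin n × Fin n → MvPolynomial ι ℂ := fun q =>
    ∑ t, MvPolynomial.C (c q t) * MvPolynomial.X t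
  have hF : ∀ k, AffSpace.polyMap (fun t => linearPoly (φ t)) (powPoint M k) = y k := by
    intro k
    funext t
    exact (evalAt_linearPoly _ _).trans (hφ t k).symm
  have hG : ∀ k, AffSpace.polyMap G (y k) = powPoint M k := by
    intro k
    funext q
    rw [hc]
    change AffSpace.evalAt (y k) (∑ t, MvPolynomial.C (c q t) * MvPolynomial.X t) = _
    rw [map_sum]
    refine Finset.sum_congr rfl fun t _ => ?_
    rw [map_mul, AffSpace.evalAt_C, AffSpace.evalAt_X]
  refine ⟨fun t => linearPoly (φ t), G, ?_, ?_⟩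
  · rintro _ ⟨k, hk, rfl⟩
    rw [hF, hG]
    exact ⟨⟨k, hk, rfl⟩, rfl⟩
  · rintro _ ⟨k, hk, rfl⟩
    change AffSpace.polyMap G (y k) ∈ _ ∧ AffSpace.polyMap _ (AffSpace.polyMap G (y k)) = y k
    rw [hG, hF]
    exact ⟨⟨k, hk, rfl⟩, rfl⟩

end Coordinates

section Monomials

open Polynomial

/-- The functions `l ↦ (N l)^w b^(l β)` on the integers. -/
noncomputable def expMonomial {r : ℕ} (N : ℕ) (b : Fin r → ℂˣ) :
    Multiplicative ((Fin r → ℤ) × ℕ) →* (ℤ → ℂ) where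
  toFun γ l := ((N : ℂ) * l) ^ (Multiplicative.toAdd γ).2 *
    (((∏ j, b j ^ (Multiplicative.toAdd γ).1 j) ^ l : ℂˣ) : ℂ)
  map_one' := by
    funext l
    simp
  map_mul' γ δ := by
    funext l
    simp only [toAdd_mul, Prod.snd_add, Prod.fst_add, Pi.add_apply, zpow_add,
      Finset.prod_mul_distrib, mul_zpow, Units.val_mul, pow_add, Pi.mul_apply]
    ring

/-- Up to nonzero factors these are the functions `l ↦ l^w μ^l`, where `μ = b^β` determines `β`
because `b` is multiplicatively independent. -/
theorem linearIndependent_expMonomial {r : ℕ} {N : ℕ} (hN : N ≠ 0) (b : Fin r → ℂˣ)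
    (hb : ∀ β : Fin r → ℤ, ∏ j, b j ^ β j = 1 → β = 0) :
    LinearIndependent ℂ fun γ : (Fin r → ℤ) × ℕ => expMonomial N b (Multiplicative.ofAdd γ) := by
  have hinj : Function.Injective fun γ : (Fin r → ℤ) × ℕ => (∏ j, b j ^ γ.1 j, γ.2) := by
    rintro ⟨β, w⟩ ⟨β', w'⟩ h
    rw [Prod.mk.injEq] at h
    refine Prod.ext (sub_eq_zero.1 (hb _ ?_)) h.2
    simp only [Pi.sub_apply, zpow_sub, Finset.prod_mul_distrib, Finset.prod_inv_distrib]
    rw [h.1, mul_inv_cancel]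
  have h := (linearIndependent_expPoly.comp _ hinj).units_smul
    (fun γ => Units.mk0 ((N : ℂ) ^ γ.2) (pow_ne_zero _ (Nat.cast_ne_zero.2 hN)))
  convert h using 1
  funext γ l
  change ((N : ℂ) * l) ^ γ.2 * _ = (N : ℂ) ^ γ.2 * (eval (l : ℂ) (X ^ γ.2) * _)
  rw [eval_pow, eval_X, mul_pow, mul_assoc]
  rfl

/-- The embedding of exponents of Laurent monomials in `r` variables times powers of one more
variable into exponents of Laurent monomials in `r + 1` variables. -/
def snocHom (r : ℕ) : (Fin r → ℤ) × ℕ →+ (Fin (r + 1) → ℤ) where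
  toFun γ := Fin.snoc (α := fun _ => ℤ) γ.1 (γ.2 : ℤ)
  map_zero' := by
    funext i
    refine Fin.lastCases ?_ (fun i => ?_) i <;> simp
  map_add' γ δ := by
    funext i
    refine Fin.lastCases ?_ (fun i => ?_) i <;> simp

theorem snocHom_injective (r : ℕ) : Function.Injective (snocHom r) := by
  rintro ⟨β, w⟩ ⟨β', w'⟩ h
  have h : Fin.snoc (α := fun _ => ℤ) β (w : ℤ) = Fin.snoc (α := fun _ => ℤ) β' (w' : ℤ) := h
  refine Prod.ext (funext fun i => ?_) ?_
  · have := congrFun h i.castSucc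
    simpa using this
  · have := congrFun h (Fin.last r)
    simpa using this

/-- The lattice of exponents in the non-diagonalizable case: an eigenvalue of multiplicity at least
two contributes `(α, 0)` and `(α, 1)`, and their difference is the last basis vector. -/
theorem closure_range_snocHom {r : ℕ} {S ι : Type*} (α : S → Fin r → ℤ)
    (hα : AddSubgroup.closure (Set.range α) = ⊤) (v : ι → (Fin r → ℤ) × ℕ)
    (h0 : ∀ u, ∃ t, v t = (α u, 0)) (h1 : ∃ u, ∃ t, v t = (α u, 1)) :
    AddSubgroup.closure (Set.range fun t => snocHom r (v t)) = ⊤ := by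
  set H := AddSubgroup.closure (Set.range fun t => snocHom r (v t)) with hH
  have hmem : ∀ t, snocHom r (v t) ∈ H := fun t => AddSubgroup.subset_closure ⟨t, rfl⟩
  have hlast : snocHom r (0, 1) ∈ H := by
    obtain ⟨u, t, ht⟩ := h1
    obtain ⟨s, hs⟩ := h0 u
    have := sub_mem (hmem t) (hmem s)
    rw [ht, hs] at this
    convert this using 1
    rw [eq_sub_iff_add_eq, ← map_add]
    simp
  have hβ : ∀ β : Fin r → ℤ, snocHom r (β, 0) ∈ H := by
    intro β
    have : β ∈ AddSubgroup.closure (Set.range α) := by rw [hα]; trivial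
    induction this using AddSubgroup.closure_induction with
    | mem x hx =>
      obtain ⟨u, rfl⟩ := hx
      obtain ⟨t, ht⟩ := h0 u
      rw [← ht]
      exact hmem t
    | zero => exact (map_zero (snocHom r)).symm ▸ zero_mem H
    | add x y _ _ hx hy =>
      have := add_mem hx hy
      rwa [← map_add] at this
    | neg x _ hx =>
      have h2 : snocHom r (-x, 0) = -snocHom r (x, 0) := by
        rw [eq_neg_iff_add_eq_zero, ← map_add, Prod.mk_add_mk, neg_add_cancel, add_zero]
        exact map_zero (snocHom r)
      rw [h2]
      exact neg_mem hx
  refine eq_top_iff.2 fun γ _ => ?_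
  have : γ = snocHom r (fun i => γ i.castSucc, 0) + γ (Fin.last r) • snocHom r (0, 1) := by
    funext i
    refine Fin.lastCases ?_ (fun i => ?_) i
    · simp [snocHom]
    · simp [snocHom]
  rw [this]
  exact add_mem (hβ _) (zsmul_mem hlast _)

end Monomials

/-! ### The closure of a cyclic matrix group -/

section CyclicClosure

open Polynomial

variable {n : ℕ} (M : GL (Fin n) ℂ)

/-- The eigenvalues of an invertible matrix, as units. -/
def eigenvalueUnits : Set ℂˣ :=
  {u : ℂˣ | Module.End.HasEigenvalue (Matrix.toLin' (M : Matrix (Fin n) (Fin n) ℂ)) (u : ℂ)}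

theorem mem_eigenvalueUnits_iff (u : ℂˣ) :
    u ∈ eigenvalueUnits M ↔
      (u : ℂ) ∈ (minpoly ℂ (M : Matrix (Fin n) (Fin n) ℂ)).roots :=
  hasEigenvalue_toLin'_iff _ _

theorem finite_eigenvalueUnits : (eigenvalueUnits M).Finite := by
  refine Set.Finite.of_finite_image (f := fun u : ℂˣ => (u : ℂ)) ?_ Units.val_injective.injOn
  refine (Multiset.finite_toSet (minpoly ℂ (M : Matrix (Fin n) (Fin n) ℂ)).roots).subset ?_
  rintro _ ⟨u, hu, rfl⟩
  exact (mem_eigenvalueUnits_iff M u).1 hu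

theorem finite_torsion_eigenvalueGroup :
    Finite (CommGroup.torsion (eigenvalueGroup (M : Matrix (Fin n) (Fin n) ℂ))) :=
  finite_torsion_closure _ (finite_eigenvalueUnits M)

/-- The closure of the powers of `M` with exponent divisible by the order `N` of the torsion of the
eigenvalue group is a toric variety. With `λ^N = b^α(λ)`, the coordinates `k^j λ^k` at `k = N l`
are the functions `(N l)^j b^(l α(λ))`, and these satisfy the same polynomial relations as the
monomials `s^j t^α(λ)`. -/
theorem exists_isomorphic_toricModel :
    ∃ (r m : ℕ) (α : Fin m → Fin r → ℤ), AddSubgroup.closure (Set.range α) = ⊤ ∧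
      AffSpace.Isomorphic (closure (powPoint M '' Set.range fun l : ℤ => (Nat.card
        (CommGroup.torsion (eigenvalueGroup (M : Matrix (Fin n) (Fin n) ℂ))) : ℤ) * l))
        (AffSpace.toricModel α) ∧
      ((M : Matrix (Fin n) (Fin n) ℂ).IsDiagonalizable →
        r = groupRank (eigenvalueGroup (M : Matrix (Fin n) (Fin n) ℂ))) ∧
      (¬ (M : Matrix (Fin n) (Fin n) ℂ).IsDiagonalizable →
        r = groupRank (eigenvalueGroup (M : Matrix (Fin n) (Fin n) ℂ)) + 1) := by
  classical
  have hfin := finite_torsion_eigenvalueGroup M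
  have hN : Nat.card (CommGroup.torsion
    (eigenvalueGroup (M : Matrix (Fin n) (Fin n) ℂ))) ≠ 0 := Nat.card_pos.ne'
  have hexp : ∃ (b : Fin (groupRank (eigenvalueGroup (M : Matrix (Fin n) (Fin n) ℂ))) → ℂˣ)
      (α : eigenvalueUnits M →
        Fin (groupRank (eigenvalueGroup (M : Matrix (Fin n) (Fin n) ℂ))) → ℤ),
      (∀ u : eigenvalueUnits M, (u : ℂˣ) ^ Nat.card (CommGroup.torsion
        (eigenvalueGroup (M : Matrix (Fin n) (Fin n) ℂ))) = ∏ j, b j ^ α u j) ∧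
      AddSubgroup.closure (Set.range α) = ⊤ ∧
      ∀ β : Fin (groupRank (eigenvalueGroup (M : Matrix (Fin n) (Fin n) ℂ))) → ℤ,
        ∏ j, b j ^ β j = 1 → β = 0 :=
    have : Finite (CommGroup.torsion (Subgroup.closure (eigenvalueUnits M))) := hfin
    exists_exponents (eigenvalueUnits M) (finite_eigenvalueUnits M)
  obtain ⟨b, α, hα, hgen, hb⟩ := hexp
  generalize groupRank (eigenvalueGroup (M : Matrix (Fin n) (Fin n) ℂ)) = r at *
  generalize Nat.card (CommGroup.torsion
    (eigenvalueGroup (M : Matrix (Fin n) (Fin n) ℂ))) = N at *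
  let J := (minpoly ℂ (M : Matrix (Fin n) (Fin n) ℂ)).roots.ToType
  let m := Fintype.card J
  let e : Fin m ≃ J := (Fintype.equivFin J).symm
  have hmem : ∀ x : J, rootUnit M x ∈ eigenvalueUnits M := by
    intro x
    rw [mem_eigenvalueUnits_iff]
    exact Multiset.coe_mem
  let v : Fin m → (Fin r → ℤ) × ℕ := fun t => (α ⟨_, hmem (e t)⟩, ((e t).2 : ℕ))
  have h0 : ∀ u, ∃ t, v t = (α u, 0) := by
    intro u
    have hu : ((u : ℂˣ) : ℂ) ∈ (minpoly ℂ (M : Matrix (Fin n) (Fin n) ℂ)).roots :=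
      (mem_eigenvalueUnits_iff M u).1 u.2
    let x : J := ⟨((u : ℂˣ) : ℂ), ⟨0, Multiset.count_pos.2 hu⟩⟩
    have hx : v (e.symm x) = (α ⟨_, hmem x⟩, (x.2 : ℕ)) := by
      simp only [v]
      rw [e.apply_symm_apply]
    have hxu : (⟨_, hmem x⟩ : eigenvalueUnits M) = u := Subtype.ext (Units.ext rfl)
    rw [hxu] at hx
    exact ⟨e.symm x, hx⟩
  let y : ℤ → AffSpace (Fin m) := fun k t => expPoly (rootUnit M (e t)) (X ^ ((e t).2 : ℕ)) k
  have hy : ∀ l t, y (N * l) t = expMonomial N b (Multiplicative.ofAdd (v t)) l := by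
    intro l t
    change eval ((N * l : ℤ) : ℂ) (X ^ ((e t).2 : ℕ)) *
        ((rootUnit M (e t) ^ (N * l : ℤ) : ℂˣ) : ℂ) =
      ((N : ℂ) * l) ^ ((e t).2 : ℕ) * (((∏ j, b j ^ α ⟨_, hmem (e t)⟩ j) ^ l : ℂˣ) : ℂ)
    rw [← hα, eval_pow, eval_X, zpow_mul, zpow_natCast]
    push_cast
    rfl
  have hiso := (isomorphic_powPoint_expPoly M (Set.range fun l : ℤ => (N : ℤ) * l) e).closure
  have himg : y '' (Set.range fun l : ℤ => (N : ℤ) * l) = Set.range fun l : ℤ => y (N * l) := by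
    rw [← Set.range_comp]
    rfl
  change AffSpace.Isomorphic _ (closure (y '' _)) at hiso
  rw [himg] at hiso
  have hli := linearIndependent_expMonomial hN b hb
  have hmodel : ∀ (r' : ℕ) (α' : Fin m → Fin r' → ℤ),
      AffSpace.vanishing (Set.range fun l : ℤ => y (N * l)) = RingHom.ker (monomialHom α') →
      closure (Set.range fun l : ℤ => y (N * l)) = AffSpace.toricModel α' := by
    intro r' α' h
    rw [AffSpace.toricModel, AffSpace.closure_eq_zeros, AffSpace.closure_eq_zeros, h,
      AffSpace.vanishing_range_monomialMap]
  by_cases hd : (M : Matrix (Fin n) (Fin n) ℂ).IsDiagonalizable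
  · -- all multiplicities are one, so there is no power of `k` among the coordinates
    have hv0 : ∀ t, (v t).2 = 0 := by
      intro t
      have h1 := (e t).2.2
      have h2 := Multiset.nodup_iff_count_le_one.1 hd.nodup_roots (e t).1
      change ((e t).2 : ℕ) = 0
      exact Nat.lt_one_iff.1 (h1.trans_le h2)
    refine ⟨r, m, fun t => (v t).1, ?_, ?_, fun _ => rfl, fun h => absurd hd h⟩
    · rw [eq_top_iff, ← hgen]
      refine AddSubgroup.closure_mono ?_
      rintro _ ⟨u, rfl⟩
      obtain ⟨t, ht⟩ := h0 u
      exact ⟨t, congrArg Prod.fst ht⟩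
    · rw [← hmodel]
      · exact hiso
      · refine AffSpace.vanishing_range
          ((expMonomial N b).comp (AddMonoidHom.toMultiplicative
            (AddMonoidHom.inl (Fin r → ℤ) ℕ)))
          (hli.comp (fun β => (β, 0)) fun β γ h => congrArg Prod.fst h) _ _ fun l t => ?_
        rw [hy]
        have : v t = ((v t).1, 0) := Prod.ext rfl (hv0 t)
        conv_lhs => rw [this]
        rfl
  · have h1 : ∃ u, ∃ t, v t = (α u, 1) := by
      have hnd : ¬ (minpoly ℂ (M : Matrix (Fin n) (Fin n) ℂ)).roots.Nodup :=
        fun h => hd (Matrix.isDiagonalizable_of_nodup_roots h)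
      rw [Multiset.nodup_iff_count_le_one] at hnd
      push Not at hnd
      obtain ⟨c, hc⟩ := hnd
      let x : J := ⟨c, ⟨1, hc⟩⟩
      have hx : v (e.symm x) = (α ⟨_, hmem x⟩, (x.2 : ℕ)) := by
        simp only [v]
        rw [e.apply_symm_apply]
      exact ⟨⟨_, hmem x⟩, e.symm x, hx⟩
    refine ⟨r + 1, m, fun t => snocHom r (v t), closure_range_snocHom α hgen v h0 h1, ?_,
      fun h => absurd h hd, fun _ => rfl⟩
    rw [← hmodel]
    · exact hiso
    · rw [ker_monomialHom_comp v (snocHom r) (snocHom_injective r)]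
      exact AffSpace.vanishing_range (expMonomial N b) hli v _ hy

/-- For every `u` in the eigenvalue group, the function `M^k ↦ u^k` is a quotient of two polynomial
functions on the powers of `M`. -/
theorem exists_polynomials_zpow {u : ℂˣ}
    (hu : u ∈ eigenvalueGroup (M : Matrix (Fin n) (Fin n) ℂ)) :
    ∃ P Q : MvPolynomial (Fin n × Fin n) ℂ, ∀ k : ℤ, AffSpace.evalAt (powPoint M k) Q ≠ 0 ∧
      AffSpace.evalAt (powPoint M k) P =
        ((u ^ k : ℂˣ) : ℂ) * AffSpace.evalAt (powPoint M k) Q := by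
  classical
  induction hu using Subgroup.closure_induction with
  | mem u hu =>
    replace hu := (mem_eigenvalueUnits_iff M u).1 hu
    -- the coordinate `k^j λ^k` with `j = 0`
    obtain ⟨φ, hφ⟩ := exists_dual_expPoly M ⟨(u : ℂ), ⟨0, Multiset.count_pos.2 hu⟩⟩
    refine ⟨linearPoly φ, 1, fun k => ⟨by simp, ?_⟩⟩
    rw [powPoint, evalAt_linearPoly, ← hφ, map_one, mul_one, expPoly_apply]
    have : rootUnit M ⟨(u : ℂ), ⟨0, Multiset.count_pos.2 hu⟩⟩ = u := Units.ext rfl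
    rw [this]
    simp
  | one => exact ⟨1, 1, fun k => by simp⟩
  | mul u v _ _ hu hv =>
    obtain ⟨P, Q, h⟩ := hu
    obtain ⟨P', Q', h'⟩ := hv
    refine ⟨P * P', Q * Q', fun k => ⟨?_, ?_⟩⟩
    · rw [map_mul]
      exact mul_ne_zero (h k).1 (h' k).1
    · rw [map_mul, map_mul, (h k).2, (h' k).2, mul_zpow, Units.val_mul]
      ring
  | inv u _ hu =>
    obtain ⟨P, Q, h⟩ := hu
    refine ⟨Q, P, fun k => ⟨?_, ?_⟩⟩
    · rw [(h k).2]
      exact mul_ne_zero (Units.ne_zero _) (h k).1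
    · rw [(h k).2, ← mul_assoc, ← Units.val_mul, inv_zpow, inv_mul_cancel, Units.val_one, one_mul]

/-- The closures of the powers of `M` over two residue classes modulo the order of the torsion of
the eigenvalue group are not contained in each other: they lie over different powers of a generator
of the torsion. -/
theorem eq_of_closure_residue_subset {a a' : ℕ}
    (ha : a < Nat.card (CommGroup.torsion (eigenvalueGroup (M : Matrix (Fin n) (Fin n) ℂ))))
    (ha' : a' < Nat.card (CommGroup.torsion (eigenvalueGroup (M : Matrix (Fin n) (Fin n) ℂ))))
    (h : powPoint M a ∈ closure (Set.range fun l : ℤ => powPoint M (a' + (Nat.card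
      (CommGroup.torsion (eigenvalueGroup (M : Matrix (Fin n) (Fin n) ℂ))) : ℤ) * l))) :
    a = a' := by
  have hfin := finite_torsion_eigenvalueGroup M
  have hcyc : IsCyclic (CommGroup.torsion (eigenvalueGroup (M : Matrix (Fin n) (Fin n) ℂ))) :=
    isCyclic_of_injective_ringHom
      ((Units.coeHom ℂ).comp ((Subgroup.subtype _).comp (Subgroup.subtype _)))
      (Units.val_injective.comp (Subtype.val_injective.comp Subtype.val_injective))
  obtain ⟨ζ, hζ⟩ := hcyc.exists_generator
  have hord := orderOf_eq_card_of_forall_mem_zpowers hζ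
  set N := Nat.card (CommGroup.torsion (eigenvalueGroup (M : Matrix (Fin n) (Fin n) ℂ))) with hN
  have hζN : ((ζ : eigenvalueGroup (M : Matrix (Fin n) (Fin n) ℂ)) : ℂˣ) ^ N = 1 := by
    have : ζ ^ N = 1 := pow_card_eq_one'
    exact congrArg (fun z : CommGroup.torsion (eigenvalueGroup (M : Matrix (Fin n) (Fin n) ℂ)) =>
      ((z : eigenvalueGroup (M : Matrix (Fin n) (Fin n) ℂ)) : ℂˣ)) this
  obtain ⟨P, Q, hPQ⟩ := exists_polynomials_zpow M
    (ζ : eigenvalueGroup (M : Matrix (Fin n) (Fin n) ℂ)).2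
  set z : ℂˣ := ((ζ : eigenvalueGroup (M : Matrix (Fin n) (Fin n) ℂ)) : ℂˣ) with hz
  -- `P - ζ^a' Q` vanishes on the powers with exponent congruent to `a'`, hence also at `M^a`
  have hv := AffSpace.mem_closure_iff_vanishing.1 h
    (P - MvPolynomial.C ((z ^ a' : ℂˣ) : ℂ) * Q) (AffSpace.mem_vanishing.2 (by
      rintro _ ⟨l, rfl⟩
      rw [map_sub, map_mul, AffSpace.evalAt_C, (hPQ _).2, zpow_add, zpow_mul, zpow_natCast,
        zpow_natCast, hζN, one_zpow, mul_one, sub_self]))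
  rw [map_sub, map_mul, AffSpace.evalAt_C, (hPQ _).2, ← sub_mul] at hv
  have h1 := sub_eq_zero.1 ((mul_eq_zero.1 hv).resolve_right (hPQ _).1)
  rw [zpow_natCast] at h1
  have h2 : ζ ^ a = ζ ^ a' := Subtype.ext (Subtype.ext (Units.ext h1))
  exact pow_injOn_Iio_orderOf (by rwa [Set.mem_Iio, hord]) (by rwa [Set.mem_Iio, hord]) h2

theorem cyclicClosure_eq : cyclicClosure M = closure (Set.range (powPoint M)) := by
  unfold cyclicClosure
  congr 1
  ext x
  constructor
  · rintro ⟨_, ⟨k, rfl⟩, rfl⟩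
    exact ⟨k, rfl⟩
  · rintro ⟨k, rfl⟩
    exact ⟨_, ⟨k, rfl⟩, rfl⟩

end CyclicClosure

theorem mainTheorem2 (n : ℕ) (M : GL (Fin n) ℂ) :
    (AffSpace.components (cyclicClosure M)).encard =
        (Nat.card (CommGroup.torsion (eigenvalueGroup (M : Matrix (Fin n) (Fin n) ℂ))) : ℕ∞) ∧
    (∀ C ∈ AffSpace.components (cyclicClosure M), AffSpace.IsToric C) ∧
    (∀ C ∈ AffSpace.components (cyclicClosure M),
      ∀ D ∈ AffSpace.components (cyclicClosure M), AffSpace.Isomorphic C D) ∧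
    ((M : Matrix (Fin n) (Fin n) ℂ).IsDiagonalizable →
      topologicalKrullDim (cyclicClosure M) =
        (groupRank (eigenvalueGroup (M : Matrix (Fin n) (Fin n) ℂ)) : WithBot ℕ∞) ∧
      ∀ C ∈ AffSpace.components (cyclicClosure M), topologicalKrullDim C =
        (groupRank (eigenvalueGroup (M : Matrix (Fin n) (Fin n) ℂ)) : WithBot ℕ∞)) ∧
    (¬ (M : Matrix (Fin n) (Fin n) ℂ).IsDiagonalizable →
      topologicalKrullDim (cyclicClosure M) =
        ((groupRank (eigenvalueGroup (M : Matrix (Fin n) (Fin n) ℂ)) + 1 : ℕ) : WithBot ℕ∞) ∧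
      ∀ C ∈ AffSpace.components (cyclicClosure M), topologicalKrullDim C =
        ((groupRank (eigenvalueGroup (M : Matrix (Fin n) (Fin n) ℂ)) + 1 : ℕ) : WithBot ℕ∞)) := by
  have hfin := finite_torsion_eigenvalueGroup M
  obtain ⟨r, m, α, hα, hiso, hdiag, hndiag⟩ := exists_isomorphic_toricModel M
  have hsep := fun {a a'} => eq_of_closure_residue_subset M (a := a) (a' := a')
  have hN : Nat.card (CommGroup.torsion
    (eigenvalueGroup (M : Matrix (Fin n) (Fin n) ℂ))) ≠ 0 := Nat.card_pos.ne'
  generalize Nat.card (CommGroup.torsion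
    (eigenvalueGroup (M : Matrix (Fin n) (Fin n) ℂ))) = N at *
  have : NeZero N := ⟨hN⟩
  let C : Fin N → Set (AffSpace (Fin n × Fin n)) := fun a =>
    closure (Set.range fun l : ℤ => powPoint M ((a : ℕ) + (N : ℤ) * l))
  have hCtoric : ∀ a, AffSpace.Isomorphic (C a) (AffSpace.toricModel α) := by
    intro a
    have h := (isomorphic_powPoint_add M (Set.range fun l : ℤ => (N : ℤ) * l) (a : ℕ)).closure
    rw [← Set.range_comp (fun k => powPoint M ((a : ℕ) + k))] at h
    exact h.symm.trans hiso
  have hcl : ∀ a, IsClosed (C a) := fun a => isClosed_closure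
  have hirr : ∀ a, IsIrreducible (C a) := fun a =>
    (hCtoric a).symm.isIrreducible (AffSpace.isIrreducible_toricModel α)
  have hinj : ∀ a a', C a ⊆ C a' → a = a' := by
    intro a a' h
    refine Fin.ext (hsep a.2 a'.2 (h (subset_closure ⟨0, ?_⟩)))
    simp
  have hunion : cyclicClosure M = ⋃ a, C a := by
    rw [cyclicClosure_eq, ← closure_iUnion_of_finite]
    congr 1
    ext x
    simp only [Set.mem_range, Set.mem_iUnion]
    constructor
    · rintro ⟨k, rfl⟩
      have hN' : (N : ℤ) ≠ 0 := by exact_mod_cast hN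
      have hk := Int.emod_nonneg k hN'
      have hk' := Int.emod_lt_of_pos k (by omega : (0 : ℤ) < N)
      refine ⟨⟨(k % N).toNat, by omega⟩, k / N, ?_⟩
      simp only [Int.toNat_of_nonneg hk, Int.emod_add_mul_ediv]
    · rintro ⟨a, l, rfl⟩
      exact ⟨_, rfl⟩
  have hcomp : AffSpace.components (cyclicClosure M) = Set.range C := by
    rw [hunion]
    exact AffSpace.components_iUnion C hcl hirr hinj
  have hdim : ∀ a, topologicalKrullDim (C a) = r := fun a =>
    (hCtoric a).topologicalKrullDim_eq.trans (AffSpace.topologicalKrullDim_toricModel α hα)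
  have hdim' : topologicalKrullDim (cyclicClosure M) = r := by
    rw [hunion]
    exact AffSpace.topologicalKrullDim_iUnion C hcl r hdim
  rw [hcomp]
  refine ⟨?_, ?_, ?_, ?_, ?_⟩
  · have hCinj : Function.Injective C := fun a a' h => hinj a a' h.subset
    rw [← Set.image_univ, hCinj.encard_image, Set.encard_univ, ENat.card_eq_coe_fintype_card,
      Fintype.card_fin]
  · rintro _ ⟨a, rfl⟩
    exact ⟨r, m, α, hCtoric a⟩
  · rintro _ ⟨a, rfl⟩ _ ⟨a', rfl⟩
    exact (hCtoric a).trans (hCtoric a').symm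
  · intro hd
    rw [hdim', hdiag hd]
    refine ⟨rfl, ?_⟩
    rintro _ ⟨a, rfl⟩
    rw [hdim, hdiag hd]
  · intro hd
    rw [hdim', hndiag hd]
    refine ⟨rfl, ?_⟩
    rintro _ ⟨a, rfl⟩
    rw [hdim, hndiag hd]
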